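/- Let $M$ be a nonempty connected open set of points $(t,r,\theta,\phi)\in\mathbb R^4$ with $r>0$ and $0<\theta<\pi$, and let $f$ be a smooth real function, without zeros, on the set of values taken by $r$ on $M$. Equip $M$ with the Lorentzian metric $$g=-f(r)\,dt^2+\frac{dr^2}{f(r)}+r^2\,(d\theta^2+\sin^2\theta\,d\phi^2).$$ Suppose that $(M,g)$ admits a Kundt congruence, i.e. a smooth nowhere vanishing null vector field $\ell$ on $M$ that is geodesic ($\nabla_\ell\ell\propto\ell$) and non-expanding, shear-free and twist-free: at every point of $M$ and for all orthonormal spacelike vectors $e_1,e_2$ orthogonal to $\ell$, the numbers $B_{ij}=g(\nabla_{e_i}\ell,e_j)$ satisfy $B_{11}+B_{22}=0$ (no expansion), $B_{11}-B_{22}=0=B_{12}+B_{21}$ (no shear) and $B_{12}-B_{21}=0$ (no twist). Then $(M,g)$ is maximally symmetric in the sense of constant curvature: there is a constant $k\in\mathbb R$ such that $R^a{}_{bcd}=k\,(\delta^a_c\,g_{bd}-\delta^a_d\,g_{bc})$ on all of $M$. Moreover $(M,g)$ is de Sitter, anti-de Sitter or Minkowski space: there is a smooth local isometry from $M$ to -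 the de Sitter hyperboloid $-X_0^2+X_1^2+X_2^2+X_3^2+X_4^2=1/k$ in $\mathbb R^{1,4}$ if $k>0$; - the anti-de Sitter hyperboloid $-X_0^2-X_1^2+X_2^2+X_3^2+X_4^2=1/k$ in $\mathbb R^{2,3}$ if $k<0$; - Minkowski space $\mathbb R^{1,3}$ if $k=0$. -/

import Mathlib

open scoped ContDiff

noncomputable section

namespace StaticKundt

/-- Points, and tangent vectors, of a coordinate patch. The coordinates are
`x 0 = t`, `x 1 = r`, `x 2 = θ`, `x 3 = φ`. -/
abbrev Coord := Fin 4 → ℝ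

/-- A field of symmetric matrices `g_{ab}(x)`: a metric in coordinates. -/
abbrev Metric := Coord → Matrix (Fin 4) (Fin 4) ℝ

/-- The partial derivative `∂_a F` at `x`. -/
def partialDeriv (a : Fin 4) (F : Coord → ℝ) (x : Coord) : ℝ :=
  fderiv ℝ F x (Pi.single a 1)

/-- The scalar product `g_{ab} u^a v^b` at `x`. -/
def scalarProd (g : Metric) (x u v : Coord) : ℝ :=
  ∑ a, ∑ b, g x a b * u a * v b

/-- The Christoffel symbol
`Γ^a_{bc} = (1/2) g^{ad} (∂_b g_{dc} + ∂_c g_{db} - ∂_d g_{bc})` of the Levi-Civita connection. -/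
def christoffel (g : Metric) (a b c : Fin 4) (x : Coord) : ℝ :=
  (1 / 2) * ∑ d, (g x)⁻¹ a d *
    (partialDeriv b (fun y => g y d c) x + partialDeriv c (fun y => g y d b) x
      - partialDeriv d (fun y => g y b c) x)

/-- The Riemann tensor
`R^a_{bcd} = ∂_c Γ^a_{db} - ∂_d Γ^a_{cb} + Γ^a_{ce} Γ^e_{db} - Γ^a_{de} Γ^e_{cb}`. -/
def riemann (g : Metric) (a b c d : Fin 4) (x : Coord) : ℝ :=
  partialDeriv c (christoffel g a d b) x - partialDeriv d (christoffel g a c b) x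
    + ∑ e, (christoffel g a c e x * christoffel g e d b x
        - christoffel g a d e x * christoffel g e c b x)

/-- `g` has constant sectional curvature `k` on `M`:
`R^a_{bcd} = k (δ^a_c g_{bd} - δ^a_d g_{bc})` throughout `M`, with the same number `k`. -/
def HasConstantCurvature (g : Metric) (M : Set Coord) (k : ℝ) : Prop :=
  ∀ x ∈ M, ∀ a b c d : Fin 4,
    riemann g a b c d x =
      k * ((if a = c then g x b d else 0) - (if a = d then g x b c else 0))

/-- The covariant derivative `(∇_u ℓ)^a = u^b (∂_b ℓ^a + Γ^a_{bc} ℓ^c)` at `x`. -/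
def covDeriv (g : Metric) (l : Coord → Coord) (x u : Coord) : Coord :=
  fun a => ∑ b, u b *
    (partialDeriv b (fun y => l y a) x + ∑ c, christoffel g a b c x * l x c)

/-- The optical form `g(∇_u ℓ, v) = v^a u^b ∇_b ℓ_a` at `x`. -/
def opticalForm (g : Metric) (l : Coord → Coord) (x u v : Coord) : ℝ :=
  scalarProd g x (covDeriv g l x u) v

/-- `e₁`, `e₂` are orthonormal spacelike vectors at `x` orthogonal to `ℓ`. -/
structure IsTransverseFrame (g : Metric) (l : Coord → Coord) (x e₁ e₂ : Coord) : Prop where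
  norm_one : scalarProd g x e₁ e₁ = 1
  norm_two : scalarProd g x e₂ e₂ = 1
  orthogonal : scalarProd g x e₁ e₂ = 0
  transverse_one : scalarProd g x e₁ (l x) = 0
  transverse_two : scalarProd g x e₂ (l x) = 0

/-- `ℓ` is tangent to a Kundt congruence on `M`: a nowhere zero null geodesic vector field (not
necessarily affinely parametrized) without expansion, shear and twist. In Newman–Penrose terms,
with `m = (e₁ + i e₂) / √2`, the conditions are `κ = 0` (`geodesic`), `Re ρ = 0` (`nonexpanding`),
`Im ρ = 0` (`twist_free`) and `σ = 0` (`shear_free`). -/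
structure IsKundtCongruence (g : Metric) (M : Set Coord) (l : Coord → Coord) : Prop where
  smooth : ContDiffOn ℝ ∞ l M
  ne_zero : ∀ x ∈ M, l x ≠ 0
  null : ∀ x ∈ M, scalarProd g x (l x) (l x) = 0
  geodesic : ∀ x ∈ M, ∃ μ : ℝ, covDeriv g l x (l x) = μ • l x
  nonexpanding : ∀ x ∈ M, ∀ e₁ e₂ : Coord, IsTransverseFrame g l x e₁ e₂ →
    opticalForm g l x e₁ e₁ + opticalForm g l x e₂ e₂ = 0
  shear_free : ∀ x ∈ M, ∀ e₁ e₂ : Coord, IsTransverseFrame g l x e₁ e₂ →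
    opticalForm g l x e₁ e₁ - opticalForm g l x e₂ e₂ = 0 ∧
      opticalForm g l x e₁ e₂ + opticalForm g l x e₂ e₁ = 0
  twist_free : ∀ x ∈ M, ∀ e₁ e₂ : Coord, IsTransverseFrame g l x e₁ e₂ →
    opticalForm g l x e₁ e₂ - opticalForm g l x e₂ e₁ = 0

/-- The metric `-f(r) dt² + dr² / f(r) + r² (dθ² + sin² θ dφ²)`. -/
def standardMetric (f : ℝ → ℝ) : Metric := fun x =>
  Matrix.diagonal ![-f (x 1), 1 / f (x 1), x 1 ^ 2, x 1 ^ 2 * Real.sin (x 2) ^ 2]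

/-- The flat scalar product `∑ i, ε i * u i * v i` on `ℝⁿ`. -/
def flatProd {n : ℕ} (ε : Fin n → ℝ) (u v : Fin n → ℝ) : ℝ := ∑ i, ε i * u i * v i

/-- `Φ` is a smooth map from `M` into `Q ⊆ ℝⁿ` that pulls the flat scalar product with signs `ε`
back to `g`. If `Q` is a four-dimensional submanifold with its induced metric, this says
that `Φ : M → Q` is a local isometry (the dimensions agree, so `Φ` is a local diffeomorphism). -/
structure IsLocalIsometry (g : Metric) (M : Set Coord) {n : ℕ} (ε : Fin n → ℝ)
    (Q : Set (Fin n → ℝ)) (Φ : Coord → Fin n → ℝ) : Prop where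
  smooth : ContDiffOn ℝ ∞ Φ M
  mapsTo : Set.MapsTo Φ M Q
  pullback : ∀ x ∈ M, ∀ u v : Coord,
    flatProd ε (fderiv ℝ Φ x u) (fderiv ℝ Φ x v) = scalarProd g x u v

/-- `(M, g)` is locally isometric to de Sitter space of radius `L`, the hyperboloid
`-X₀² + X₁² + X₂² + X₃² + X₄² = L²` in `ℝ^{1,4}`. -/
def IsLocallyDeSitter (g : Metric) (M : Set Coord) (L : ℝ) : Prop :=
  ∃ Φ : Coord → Fin 5 → ℝ, IsLocalIsometry g M ![-1, 1, 1, 1, 1]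
    {X | flatProd ![-1, 1, 1, 1, 1] X X = L ^ 2} Φ

/-- `(M, g)` is locally isometric to anti-de Sitter space of radius `L`, the hyperboloid
`-X₀² - X₁² + X₂² + X₃² + X₄² = -L²` in `ℝ^{2,3}`. -/
def IsLocallyAntiDeSitter (g : Metric) (M : Set Coord) (L : ℝ) : Prop :=
  ∃ Φ : Coord → Fin 5 → ℝ, IsLocalIsometry g M ![-1, -1, 1, 1, 1]
    {X | flatProd ![-1, -1, 1, 1, 1] X X = -L ^ 2} Φ

/-- `(M, g)` is locally isometric to Minkowski space `ℝ^{1,3}`. -/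
def IsLocallyMinkowski (g : Metric) (M : Set Coord) : Prop :=
  ∃ Φ : Coord → Fin 4 → ℝ, IsLocalIsometry g M ![-1, 1, 1, 1] Set.univ Φ

end StaticKundt

end

/-! The geodesic condition, nullity and the three optical conditions together say that g(∇_u ℓ, v)
vanishes for all u, v in ℓ^⊥ (`IsKundtCongruence.opticalForm_eq_zero`): geometrically, ℓ^⊥ is
tangent to totally geodesic null hypersurfaces. The Codazzi equation then constrains the curvature.
For this metric the θφ-plane has sectional curvature (1 - f)/r², and the planes spanned by an
angular direction and ∂_t or ∂_r have -f'/(2r). The difference of these, times the angular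
components of ℓ, must vanish.

Concretely, the covector ξ dual to ℓ is divided by a nonzero component ξ_n, with n = t or n = r,
giving p = ξ/ξ_n. The fields X_b = ∂_b - p_b ∂_n lie in ℓ^⊥, and the vanishing of the optical form
becomes a first-order system for p (`fderiv_ratio`). Its symmetry makes X_θ and X_φ commute.
Evaluating X_θ X_φ = X_φ X_θ on p_θ and p_φ gives p_θ E = p_φ E = 0 with E = 1 - f + r f'/2
(`integrability_static`, `integrability_radial`). If E ≠ 0 at a point, the angular components vanish
near it, which the same system forbids: radial null rays expand. So E = 0 everywhere
(`IsKundtCongruence.deriv_eq`), and f = 1 - k r².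

For this f the curvature is a finite computation (`hasConstantCurvature`), and the classical static
charts supply the local isometries (`isLocalIsometry_staticEmbedding`). -/

namespace StaticKundt

/-! ### The metric, its connection and the optical form in coordinates -/

lemma hasFDerivAt_comp_coord {h : ℝ → ℝ} {h' : ℝ} {x : Coord} (i : Fin 4)
    (hh : HasDerivAt h h' (x i)) :
    HasFDerivAt (fun y : Coord => h (y i))
      (h' • (ContinuousLinearMap.proj i : Coord →L[ℝ] ℝ)) x :=
  HasDerivAt.comp_hasFDerivAt (f := fun y : Coord => y i) x hh
    (ContinuousLinearMap.proj (R := ℝ) (φ := fun _ : Fin 4 => ℝ) i).hasFDerivAt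

/-- A product of a function of `r` and a function of `θ`. -/
lemma hasFDerivAt_mul_coord {h k : ℝ → ℝ} {h' k' : ℝ} {x : Coord}
    (hh : HasDerivAt h h' (x 1)) (hk : HasDerivAt k k' (x 2)) :
    HasFDerivAt (fun y : Coord => h (y 1) * k (y 2))
      ((h' * k (x 2)) • (ContinuousLinearMap.proj 1 : Coord →L[ℝ] ℝ)
        + (h (x 1) * k') • (ContinuousLinearMap.proj 2 : Coord →L[ℝ] ℝ)) x := by
  refine ((hasFDerivAt_comp_coord 1 hh).mul (hasFDerivAt_comp_coord 2 hk)).congr_fderiv ?_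
  ext u
  simp
  ring

/-- The diagonal entries of the metric. -/
noncomputable def diagEntry (f : ℝ → ℝ) (a : Fin 4) (x : Coord) : ℝ :=
  (![-f (x 1), 1 / f (x 1), x 1 ^ 2, x 1 ^ 2 * Real.sin (x 2) ^ 2] : Fin 4 → ℝ) a

lemma standardMetric_apply (f : ℝ → ℝ) (x : Coord) (a b : Fin 4) :
    standardMetric f x a b = if a = b then diagEntry f a x else 0 := by
  simp only [standardMetric, Matrix.diagonal_apply, diagEntry]

lemma scalarProd_standard (f : ℝ → ℝ) (x u v : Coord) :
    scalarProd (standardMetric f) x u v =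
      -f (x 1) * u 0 * v 0 + 1 / f (x 1) * u 1 * v 1 + x 1 ^ 2 * u 2 * v 2
        + x 1 ^ 2 * Real.sin (x 2) ^ 2 * u 3 * v 3 := by
  simp [scalarProd, standardMetric_apply, diagEntry, Fin.sum_univ_four]

/-- The `r`-derivatives of the diagonal entries. -/
noncomputable def diagDerivR (F F' r s : ℝ) : Fin 4 → ℝ := ![-F', -F' / F ^ 2, 2 * r, 2 * r * s ^ 2]

/-- The `θ`-derivatives of the diagonal entries. -/
noncomputable def diagDerivTheta (r s c : ℝ) : Fin 4 → ℝ := ![0, 0, 0, r ^ 2 * (2 * s * c)]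

lemma hasFDerivAt_diagEntry {f : ℝ → ℝ} {F' : ℝ} {x : Coord} (hf : HasDerivAt f F' (x 1))
    (h0 : f (x 1) ≠ 0) (a : Fin 4) :
    HasFDerivAt (diagEntry f a)
      (diagDerivR (f (x 1)) F' (x 1) (Real.sin (x 2)) a •
          (ContinuousLinearMap.proj 1 : Coord →L[ℝ] ℝ)
        + diagDerivTheta (x 1) (Real.sin (x 2)) (Real.cos (x 2)) a •
          (ContinuousLinearMap.proj 2 : Coord →L[ℝ] ℝ)) x := by
  have hsq : HasDerivAt (fun r : ℝ => r ^ 2) (2 * x 1) (x 1) := by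
    simpa using hasDerivAt_pow 2 (x 1)
  have hsin : HasDerivAt (fun θ : ℝ => Real.sin θ ^ 2) (2 * Real.sin (x 2) * Real.cos (x 2))
      (x 2) := by
    simpa using (Real.hasDerivAt_sin (x 2)).fun_pow 2
  fin_cases a
  · change HasFDerivAt (fun y : Coord => -f (y 1)) _ x
    simpa [diagDerivR, diagDerivTheta] using hasFDerivAt_comp_coord 1 hf.neg
  · change HasFDerivAt (fun y : Coord => 1 / f (y 1)) _ x
    simpa [diagDerivR, diagDerivTheta] using hasFDerivAt_comp_coord 1 (hf.inv h0)
  · change HasFDerivAt (fun y : Coord => y 1 ^ 2) _ x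
    simpa [diagDerivR, diagDerivTheta] using hasFDerivAt_comp_coord 1 hsq
  · change HasFDerivAt (fun y : Coord => y 1 ^ 2 * Real.sin (y 2) ^ 2) _ x
    simpa [diagDerivR, diagDerivTheta] using hasFDerivAt_mul_coord hsq hsin

lemma partialDeriv_standardMetric {f : ℝ → ℝ} {F' : ℝ} {x : Coord}
    (hf : HasDerivAt f F' (x 1)) (h0 : f (x 1) ≠ 0) (a b c : Fin 4) :
    partialDeriv c (fun y => standardMetric f y a b) x =
      if a = b then
        diagDerivR (f (x 1)) F' (x 1) (Real.sin (x 2)) a * (if c = 1 then 1 else 0)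
          + diagDerivTheta (x 1) (Real.sin (x 2)) (Real.cos (x 2)) a * (if c = 2 then 1 else 0)
      else 0 := by
  simp only [partialDeriv, standardMetric_apply]
  split_ifs with hab
  all_goals
    first
    | (change fderiv ℝ (diagEntry f a) x _ = _
       rw [(hasFDerivAt_diagEntry hf h0 a).fderiv]
       simp [*])
    | simp
  all_goals simp_all [eq_comm]

lemma inv_standardMetric {f : ℝ → ℝ} {x : Coord} (h0 : f (x 1) ≠ 0) (hr : x 1 ≠ 0)
    (hs : Real.sin (x 2) ≠ 0) (a b : Fin 4) :
    (standardMetric f x)⁻¹ a b = if a = b then (diagEntry f a x)⁻¹ else 0 := by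
  have hd : ∀ a, diagEntry f a x ≠ 0 := by
    intro a
    fin_cases a <;> simp [diagEntry, h0, hr, hs]
  have h : (standardMetric f x)⁻¹ = Matrix.diagonal fun a => (diagEntry f a x)⁻¹ := by
    apply Matrix.inv_eq_left_inv
    rw [standardMetric, Matrix.diagonal_mul_diagonal, ← Matrix.diagonal_one]
    congr 1
    ext a
    exact inv_mul_cancel₀ (hd a)
  rw [h, Matrix.diagonal_apply]

/-- The radial factors of the Christoffel symbols. -/
noncomputable def christoffelR (F F' r : ℝ) : Fin 4 → Fin 4 → Fin 4 → ℝ :=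
  ![![![0, F' / (2 * F), 0, 0], ![F' / (2 * F), 0, 0, 0], ![0, 0, 0, 0], ![0, 0, 0, 0]],
    ![![F * F' / 2, 0, 0, 0], ![0, -F' / (2 * F), 0, 0], ![0, 0, -(r * F), 0],
      ![0, 0, 0, -(r * F)]],
    ![![0, 0, 0, 0], ![0, 0, 1 / r, 0], ![0, 1 / r, 0, 0], ![0, 0, 0, 1]],
    ![![0, 0, 0, 0], ![0, 0, 0, 1 / r], ![0, 0, 0, 1], ![0, 1 / r, 1, 0]]]

/-- The angular factors of the Christoffel symbols. -/
noncomputable def christoffelTheta (s c : ℝ) : Fin 4 → Fin 4 → Fin 4 → ℝ :=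
  ![fun _ _ => 1,
    ![fun _ => 1, fun _ => 1, fun _ => 1, ![1, 1, 1, s ^ 2]],
    ![fun _ => 1, fun _ => 1, fun _ => 1, ![1, 1, 1, -(s * c)]],
    ![fun _ => 1, fun _ => 1, ![1, 1, 1, c / s], ![1, 1, c / s, 1]]]

/-- Every symbol is a function of r times a function of θ, so its partial derivatives reduce to
one-variable derivatives. The value F' of the derivative is a parameter, which serves both a general
f and f = 1 - k r². -/
lemma christoffel_standardMetric {f : ℝ → ℝ} {F' : ℝ} {x : Coord}
    (hf : HasDerivAt f F' (x 1)) (h0 : f (x 1) ≠ 0) (hr : x 1 ≠ 0)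
    (hs : Real.sin (x 2) ≠ 0) (a b c : Fin 4) :
    christoffel (standardMetric f) a b c x =
      christoffelR (f (x 1)) F' (x 1) a b c
        * christoffelTheta (Real.sin (x 2)) (Real.cos (x 2)) a b c := by
  have key : christoffel (standardMetric f) a b c x = 1 / 2 * ((diagEntry f a x)⁻¹ *
      (partialDeriv b (fun y => standardMetric f y a c) x
        + partialDeriv c (fun y => standardMetric f y a b) x
        - partialDeriv a (fun y => standardMetric f y b c) x)) := by
    simp [christoffel, inv_standardMetric h0 hr hs]
  rw [key]
  simp only [partialDeriv_standardMetric hf h0]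
  fin_cases a <;> fin_cases b <;> fin_cases c <;>
    simp [diagEntry, diagDerivR, diagDerivTheta, christoffelR, christoffelTheta] <;>
    field_simp

/-- The covector field dual to `l`. -/
noncomputable def lower (f : ℝ → ℝ) (l : Coord → Coord) (a : Fin 4) (x : Coord) : ℝ :=
  diagEntry f a x * l x a

lemma fderiv_lower {f : ℝ → ℝ} {F' : ℝ} {l : Coord → Coord} {x : Coord}
    (hf : HasDerivAt f F' (x 1)) (h0 : f (x 1) ≠ 0) (hl : DifferentiableAt ℝ l x)
    (a : Fin 4) (u : Coord) :
    fderiv ℝ (lower f l a) x u =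
      diagEntry f a x * fderiv ℝ (fun y => l y a) x u
      + (diagDerivR (f (x 1)) F' (x 1) (Real.sin (x 2)) a * u 1
        + diagDerivTheta (x 1) (Real.sin (x 2)) (Real.cos (x 2)) a * u 2) * l x a := by
  have h : fderiv ℝ (lower f l a) x = _ :=
    ((hasFDerivAt_diagEntry hf h0 a).mul (differentiableAt_pi.1 hl a).hasFDerivAt).fderiv
  rw [h]
  simp
  ring

/-- The contraction `Γ^c_{ab} ξ_c u^a v^b`, where `F = f r`, `F' = f' r`, `s = sin θ`,
`c = cos θ`. -/
noncomputable def christoffelForm (F F' r s c : ℝ) (ξ : Fin 4 → ℝ) (u v : Coord) : ℝ :=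
  F' / (2 * F) * (u 0 * v 1 + u 1 * v 0) * ξ 0
    + (F * F' / 2 * (u 0 * v 0) - F' / (2 * F) * (u 1 * v 1) - r * F * (u 2 * v 2)
        - r * F * s ^ 2 * (u 3 * v 3)) * ξ 1
    + ((u 1 * v 2 + u 2 * v 1) / r - s * c * (u 3 * v 3)) * ξ 2
    + ((u 1 * v 3 + u 3 * v 1) / r + c / s * (u 2 * v 3 + u 3 * v 2)) * ξ 3

/-- `opticalForm` in terms of the lowered field, `v^a u^b (∂_b ξ_a - Γ^c_{ab} ξ_c)`. -/
lemma opticalForm_standardMetric {f : ℝ → ℝ} {F' : ℝ} {l : Coord → Coord} {x : Coord}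
    (hf : HasDerivAt f F' (x 1)) (h0 : f (x 1) ≠ 0) (hr : x 1 ≠ 0)
    (hs : Real.sin (x 2) ≠ 0) (hl : DifferentiableAt ℝ l x) (u v : Coord) :
    opticalForm (standardMetric f) l x u v =
      (∑ a, v a * fderiv ℝ (lower f l a) x u)
      - christoffelForm (f (x 1)) F' (x 1) (Real.sin (x 2)) (Real.cos (x 2))
          (fun a => lower f l a x) u v := by
  have hlow := fun a => fderiv_lower hf h0 hl a u
  have hsum : ∀ a, ∑ b, u b * partialDeriv b (fun y => l y a) x =
      fderiv ℝ (fun y => l y a) x u := by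
    intro a
    conv_rhs => rw [pi_eq_sum_univ' u]
    simp [partialDeriv, map_sum]
  have hcov : ∀ a, covDeriv (standardMetric f) l x u a =
      fderiv ℝ (fun y => l y a) x u
        + ∑ b, ∑ c, christoffelR (f (x 1)) F' (x 1) a b c
        * christoffelTheta (Real.sin (x 2)) (Real.cos (x 2)) a b c * u b * l x c := by
    intro a
    rw [← hsum a, ← Finset.sum_add_distrib]
    simp only [covDeriv, christoffel_standardMetric hf h0 hr hs, mul_add, Finset.mul_sum]
    refine Finset.sum_congr rfl fun b _ => ?_
    congr 1
    refine Finset.sum_congr rfl fun c _ => ?_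
    ring
  rw [opticalForm, scalarProd_standard]
  simp only [hcov, hlow, Fin.sum_univ_four, christoffelForm, lower]
  simp [christoffelR, christoffelTheta, diagEntry, diagDerivR, diagDerivTheta]
  field_simp
  ring

/-! ### The optical form on the orthogonal complement of ℓ -/

lemma scalarProd_add_smul_right (g : Metric) (x u v w : Coord) (s : ℝ) :
    scalarProd g x u (v + s • w) = scalarProd g x u v + s * scalarProd g x u w := by
  simp only [scalarProd, Pi.add_apply, Pi.smul_apply, smul_eq_mul, Finset.mul_sum,
    ← Finset.sum_add_distrib]
  exact Finset.sum_congr rfl fun a _ => Finset.sum_congr rfl fun b _ => by ring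

lemma scalarProd_add_smul_left (g : Metric) (x u v w : Coord) (s : ℝ) :
    scalarProd g x (u + s • w) v = scalarProd g x u v + s * scalarProd g x w v := by
  simp only [scalarProd, Pi.add_apply, Pi.smul_apply, smul_eq_mul, Finset.mul_sum,
    ← Finset.sum_add_distrib]
  exact Finset.sum_congr rfl fun a _ => Finset.sum_congr rfl fun b _ => by ring

lemma scalarProd_standard_comm (f : ℝ → ℝ) (x u v : Coord) :
    scalarProd (standardMetric f) x u v = scalarProd (standardMetric f) x v u := by
  simp only [scalarProd_standard]
  ring

lemma covDeriv_add_smul (g : Metric) (l : Coord → Coord) (x u w : Coord) (s : ℝ) :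
    covDeriv g l x (u + s • w) = covDeriv g l x u + s • covDeriv g l x w := by
  ext a
  simp only [covDeriv, Pi.add_apply, Pi.smul_apply, smul_eq_mul, Finset.mul_sum (a := s),
    ← Finset.sum_add_distrib]
  exact Finset.sum_congr rfl fun b _ => by ring

lemma opticalForm_add_smul_left (g : Metric) (l : Coord → Coord) (x u v w : Coord) (s : ℝ) :
    opticalForm g l x (u + s • w) v = opticalForm g l x u v + s * opticalForm g l x w v := by
  rw [opticalForm, covDeriv_add_smul, scalarProd_add_smul_left, opticalForm, opticalForm]

lemma opticalForm_add_smul_right (g : Metric) (l : Coord → Coord) (x u v w : Coord) (s : ℝ) :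
    opticalForm g l x u (v + s • w) = opticalForm g l x u v + s * opticalForm g l x u w :=
  scalarProd_add_smul_right ..

lemma opticalForm_smul_left (g : Metric) (l : Coord → Coord) (x u v : Coord) (s : ℝ) :
    opticalForm g l x (s • u) v = s * opticalForm g l x u v := by
  have h0 := opticalForm_add_smul_left g l x 0 v 0 1
  have h := opticalForm_add_smul_left g l x 0 v u s
  simp only [smul_zero, add_zero, zero_add] at h0 h
  linarith

lemma opticalForm_smul_right (g : Metric) (l : Coord → Coord) (x u v : Coord) (s : ℝ) :
    opticalForm g l x u (s • v) = s * opticalForm g l x u v := by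
  have h0 := opticalForm_add_smul_right g l x u 0 0 1
  have h := opticalForm_add_smul_right g l x u 0 v s
  simp only [smul_zero, add_zero, zero_add] at h0 h
  linarith

/-- A nonzero null vector has a transverse frame which, together with the vector itself, spans
its orthogonal complement. -/
lemma exists_transverseFrame {f : ℝ → ℝ} {l : Coord → Coord} {x : Coord}
    (h0 : f (x 1) ≠ 0) (hr : x 1 ≠ 0) (hs : Real.sin (x 2) ≠ 0) (hl : l x ≠ 0)
    (hnull : scalarProd (standardMetric f) x (l x) (l x) = 0) :
    ∃ e₁ e₂, IsTransverseFrame (standardMetric f) l x e₁ e₂ ∧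
      ∀ w, scalarProd (standardMetric f) x w (l x) = 0 →
        ∃ α β γ : ℝ, w = α • l x + β • e₁ + γ • e₂ := by
  obtain ⟨a, b, c, d, hlx⟩ : ∃ a b c d, l x = ![a, b, c, d] :=
    ⟨l x 0, l x 1, l x 2, l x 3, by ext i; fin_cases i <;> rfl⟩
  set r := x 1 with hr'
  set s := Real.sin (x 2) with hs'
  set F := f r with hF'
  simp only [scalarProd_standard, hlx, ← hr', ← hs', ← hF'] at hnull ⊢
  simp at hnull
  -- If ℓ has no angular part, the unit vectors along ∂_θ and ∂_φ serve. Otherwise, with ρ the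
  -- length of the angular part, e₁ is that part turned by a right angle in the sphere and
  -- normalized, and e₂ is the unit vector of the tr-plane orthogonal to ℓ.
  by_cases hρ : c = 0 ∧ d = 0
  · obtain ⟨rfl, rfl⟩ := hρ
    refine ⟨![0, 0, 1 / r, 0], ![0, 0, 0, 1 / (r * s)], ?_, ?_⟩
    · constructor <;> simp [scalarProd_standard, hlx, ← hr', ← hs', ← hF'] <;> field_simp
    · intro w hw
      simp at hw
      have ha : a ≠ 0 := by
        rintro rfl
        have : b = 0 := by simpa [h0] using hnull
        exact hl (by rw [hlx, this]; ext i; fin_cases i <;> rfl)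
      have hb : b ^ 2 = F ^ 2 * a ^ 2 := by field_simp at hnull; linarith
      have hb0 : b ≠ 0 := by
        rintro rfl
        have : F ^ 2 * a ^ 2 ≠ 0 := by positivity
        exact this (by rw [← hb]; ring)
      refine ⟨w 0 / a, r * w 2, r * s * w 3, ?_⟩
      ext i
      fin_cases i <;> simp
      · field_simp
      · field_simp at hw ⊢
        apply mul_left_cancel₀ hb0
        linear_combination a * hw - w 0 * hb
      · field_simp
      · field_simp
  · have hρ2 : 0 < r ^ 2 * c ^ 2 + r ^ 2 * s ^ 2 * d ^ 2 := by
      rcases not_and_or.1 hρ with h | h <;> positivity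
    obtain ⟨ρ, hρ0, hρe⟩ : ∃ ρ : ℝ, ρ ≠ 0 ∧ ρ ^ 2 = r ^ 2 * c ^ 2 + r ^ 2 * s ^ 2 * d ^ 2 :=
      ⟨Real.sqrt _, (Real.sqrt_pos.2 hρ2).ne', Real.sq_sqrt hρ2.le⟩
    have hρb : F ^ 2 * a ^ 2 - b ^ 2 = F * ρ ^ 2 := by
      rw [hρe]; field_simp at hnull; linarith
    refine ⟨![0, 0, -(s * d) / ρ, c / (s * ρ)], ![b / (F * ρ), F * a / ρ, 0, 0], ?_, ?_⟩
    · constructor <;> simp [scalarProd_standard, hlx, ← hr', ← hs', ← hF'] <;> field_simp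
      · linear_combination -hρe
      · linear_combination hρb
      · ring
      · ring
    · intro w hw
      simp at hw
      -- The last two coefficients are g(w, e₁) and g(w, e₂). The first compares angular parts: that
      -- of e₁ is orthogonal to that of ℓ, and e₂ has none.
      refine ⟨(r ^ 2 * c * w 2 + r ^ 2 * s ^ 2 * d * w 3) / ρ ^ 2,
        r ^ 2 * s * (c * w 3 - d * w 2) / ρ, (a * w 1 - b * w 0) / ρ, ?_⟩
      field_simp at hw
      ext i
      fin_cases i <;> simp <;> field_simp
      · linear_combination -w 0 * hρb - a * hw
      · apply mul_left_cancel₀ h0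
        linear_combination -w 1 * hρb - b * hw
      · linear_combination w 2 * hρe
      · linear_combination w 3 * hρe

/-- Metric compatibility: `g(∇_u ℓ, ℓ) = 0` for a null field `ℓ`. -/
lemma opticalForm_self_right {f : ℝ → ℝ} {F' : ℝ} {l : Coord → Coord} {x : Coord}
    (hf : HasDerivAt f F' (x 1)) (h0 : f (x 1) ≠ 0) (hr : x 1 ≠ 0)
    (hs : Real.sin (x 2) ≠ 0) (hl : DifferentiableAt ℝ l x)
    (hnull : ∀ᶠ y in nhds x, scalarProd (standardMetric f) y (l y) (l y) = 0) (u : Coord) :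
    opticalForm (standardMetric f) l x u (l x) = 0 := by
  have hla := differentiableAt_pi.1 hl
  have hd : ∀ a, DifferentiableAt ℝ (lower f l a) x := fun a =>
    (hasFDerivAt_diagEntry hf h0 a).differentiableAt.mul (hla a)
  -- The sum is g(ℓ, ℓ), zero near x; its derivative along u is 2 g(∇_u ℓ, ℓ).
  have key : fderiv ℝ (fun y => ∑ a, lower f l a y * l y a) x u = 0 := by
    have : (fun y => ∑ a, lower f l a y * l y a) =ᶠ[nhds x] fun _ => 0 := by
      filter_upwards [hnull] with y hy
      rw [← hy, scalarProd_standard]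
      simp [Fin.sum_univ_four, lower, diagEntry]
    rw [this.fderiv_eq]
    simp
  have hsum : HasFDerivAt (fun y => ∑ a, lower f l a y * l y a) _ x :=
    HasFDerivAt.fun_sum fun a _ => (hd a).hasFDerivAt.mul (hla a).hasFDerivAt
  rw [hsum.fderiv] at key
  rw [opticalForm_standardMetric hf h0 hr hs hl]
  simp only [add_apply, smul_apply, smul_eq_mul, fderiv_lower hf h0 hl,
    Fin.sum_univ_four, christoffelForm, lower, diagEntry, diagDerivR, diagDerivTheta] at key ⊢
  simp at key ⊢
  field_simp at key ⊢
  linear_combination key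

/-- For a Kundt congruence the optical form vanishes on the orthogonal complement of `ℓ`. -/
lemma IsKundtCongruence.opticalForm_eq_zero {f : ℝ → ℝ} {M : Set Coord} {l : Coord → Coord}
    (hK : IsKundtCongruence (standardMetric f) M l) (hM : IsOpen M) {x : Coord} (hx : x ∈ M)
    (hf : DifferentiableAt ℝ f (x 1)) (h0 : f (x 1) ≠ 0) (hr : x 1 ≠ 0)
    (hs : Real.sin (x 2) ≠ 0) {u v : Coord}
    (hu : scalarProd (standardMetric f) x u (l x) = 0)
    (hv : scalarProd (standardMetric f) x v (l x) = 0) :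
    opticalForm (standardMetric f) l x u v = 0 := by
  have hnhds := hM.mem_nhds hx
  obtain ⟨e₁, e₂, he, hspan⟩ := exists_transverseFrame h0 hr hs (hK.ne_zero x hx) (hK.null x hx)
  obtain ⟨α, β, γ, rfl⟩ := hspan u hu
  obtain ⟨α', β', γ', rfl⟩ := hspan v hv
  have hl : DifferentiableAt ℝ l x := (hK.smooth.contDiffAt hnhds).differentiableAt (by simp)
  have hself : ∀ w, opticalForm (standardMetric f) l x w (l x) = 0 :=
    opticalForm_self_right hf.hasDerivAt h0 hr hs hl
      (Filter.eventually_of_mem hnhds fun y hy => hK.null y hy)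
  obtain ⟨μ, hμ⟩ := hK.geodesic x hx
  -- ∇_ℓ ℓ is proportional to ℓ, hence orthogonal to every w in ℓ^⊥.
  have hgeo : ∀ w, scalarProd (standardMetric f) x w (l x) = 0 →
      opticalForm (standardMetric f) l x (l x) w = 0 := by
    intro w hw
    have := scalarProd_add_smul_left (standardMetric f) x 0 w (l x) μ
    rw [opticalForm, hμ]
    rw [zero_add, scalarProd_standard_comm f x (l x), hw] at this
    rw [this]
    simp [scalarProd]
  have h1 := hK.nonexpanding x hx e₁ e₂ he
  obtain ⟨h2, h3⟩ := hK.shear_free x hx e₁ e₂ he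
  have h4 := hK.twist_free x hx e₁ e₂ he
  -- The expansion, shear and twist conditions are four linear equations that determine the four
  -- transverse components. The entries involving ℓ itself vanish by `hself` and `hgeo`, and
  -- bilinearity does the rest.
  have h11 : opticalForm (standardMetric f) l x e₁ e₁ = 0 := by linarith
  have h22 : opticalForm (standardMetric f) l x e₂ e₂ = 0 := by linarith
  have h12 : opticalForm (standardMetric f) l x e₁ e₂ = 0 := by linarith
  have h21 : opticalForm (standardMetric f) l x e₂ e₁ = 0 := by linarith
  simp only [opticalForm_add_smul_left, opticalForm_add_smul_right, opticalForm_smul_left,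
    opticalForm_smul_right, hself, hgeo _ he.transverse_one, hgeo _ he.transverse_two,
    h11, h22, h12, h21]
  simp

/-! ### Commutators and integrability conditions -/

/-- The fields `a - P n` and `b - Q n` commute if the derivative of `Q` along the first equals the
derivative of `P` along the second. -/
lemma fderiv_fderiv_comm {F P Q : Coord → ℝ} {x : Coord} (a b n : Coord)
    (hF : ContDiffAt ℝ 2 F x) (hP : DifferentiableAt ℝ P x) (hQ : DifferentiableAt ℝ Q x)
    (h : fderiv ℝ Q x (a - P x • n) = fderiv ℝ P x (b - Q x • n)) :
    fderiv ℝ (fun y => fderiv ℝ F y (a - P y • n)) x (b - Q x • n) =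
      fderiv ℝ (fun y => fderiv ℝ F y (b - Q y • n)) x (a - P x • n) := by
  have hF' : HasFDerivAt (fderiv ℝ F) (fderiv ℝ (fderiv ℝ F) x) x :=
    ((hF.fderiv_right (m := 1) (by norm_num)).differentiableAt (by simp)).hasFDerivAt
  have hsymm : IsSymmSndFDerivAt ℝ F x := hF.isSymmSndFDerivAt (by simp)
  have hv : ∀ {P : Coord → ℝ} (_ : DifferentiableAt ℝ P x) (a : Coord),
      HasFDerivAt (fun y => a - P y • n) (-((fderiv ℝ P x).smulRight n)) x := fun hP a =>
    (hP.hasFDerivAt.smul_const n).const_sub a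
  rw [(hF'.clm_apply (hv hP a)).fderiv, (hF'.clm_apply (hv hQ b)).fderiv]
  -- The second-order terms agree by symmetry of D²F. The first-order terms are multiples of DF(n),
  -- with the coefficients that `h` equates.
  have h1 := hsymm.eq (b - Q x • n) (a - P x • n)
  simp only [add_apply, ContinuousLinearMap.comp_apply, ContinuousLinearMap.flip_apply, neg_apply,
    ContinuousLinearMap.smulRight_apply, map_neg, map_smul, h1, h]

section Coordinates

variable {x : Coord}

lemma hasFDerivAt_coord (i : Fin 4) :
    HasFDerivAt (fun y : Coord => y i) (ContinuousLinearMap.proj i : Coord →L[ℝ] ℝ) x :=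
  (ContinuousLinearMap.proj (R := ℝ) (φ := fun _ : Fin 4 => ℝ) i).hasFDerivAt

lemma hasFDerivAt_cot (hs : Real.sin (x 2) ≠ 0) :
    HasFDerivAt (fun y : Coord => Real.cos (y 2) / Real.sin (y 2))
      ((-1 - (Real.cos (x 2) / Real.sin (x 2)) ^ 2) •
        (ContinuousLinearMap.proj 2 : Coord →L[ℝ] ℝ)) x := by
  refine hasFDerivAt_comp_coord (h := fun t => Real.cos t / Real.sin t) 2 ?_
  refine ((Real.hasDerivAt_cos (x 2)).fun_div (Real.hasDerivAt_sin (x 2)) hs).congr_deriv ?_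
  field_simp

lemma hasFDerivAt_sin_mul_sin :
    HasFDerivAt (fun y : Coord => Real.sin (y 2) * Real.sin (y 2))
      ((2 * Real.sin (x 2) * Real.cos (x 2)) •
        (ContinuousLinearMap.proj 2 : Coord →L[ℝ] ℝ)) x := by
  refine hasFDerivAt_comp_coord (h := fun t => Real.sin t * Real.sin t) 2 ?_
  exact ((Real.hasDerivAt_sin (x 2)).fun_mul (Real.hasDerivAt_sin (x 2))).congr_deriv (by ring)

lemma hasFDerivAt_sin_mul_cos :
    HasFDerivAt (fun y : Coord => Real.sin (y 2) * Real.cos (y 2))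
      ((Real.cos (x 2) ^ 2 - Real.sin (x 2) ^ 2) •
        (ContinuousLinearMap.proj 2 : Coord →L[ℝ] ℝ)) x := by
  refine hasFDerivAt_comp_coord (h := fun t => Real.sin t * Real.cos t) 2 ?_
  exact ((Real.hasDerivAt_sin (x 2)).fun_mul (Real.hasDerivAt_cos (x 2))).congr_deriv (by ring)

end Coordinates

/-- Integrability conditions for a covector field `p` with `p_r = 1` and vanishing optical form. -/
lemma integrability_radial {f k p q : Coord → ℝ}
    {F F' K' : ℝ} {x : Coord} (hr : x 1 ≠ 0) (hs : Real.sin (x 2) ≠ 0) (hF0 : F ≠ 0)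
    (hfx : f x = F) (hkx : k x = -2 / x 1 - F' / (2 * F))
    (hf : HasFDerivAt f (F' • (ContinuousLinearMap.proj 1 : Coord →L[ℝ] ℝ)) x)
    (hk : HasFDerivAt k (K' • (ContinuousLinearMap.proj 1 : Coord →L[ℝ] ℝ)) x)
    (hp : ContDiffAt ℝ 2 p x) (hq : ContDiffAt ℝ 2 q x)
    (hpp : (fun y => fderiv ℝ p y (Pi.single 2 1 - p y • Pi.single 1 1)) =ᶠ[nhds x]
      fun y => -(y 1 * f y) + k y * (p y * p y))
    (hqp : (fun y => fderiv ℝ q y (Pi.single 2 1 - p y • Pi.single 1 1)) =ᶠ[nhds x]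
      fun y => Real.cos (y 2) / Real.sin (y 2) * q y + k y * (p y * q y))
    (hpq : (fun y => fderiv ℝ p y (Pi.single 3 1 - q y • Pi.single 1 1)) =ᶠ[nhds x]
      fun y => Real.cos (y 2) / Real.sin (y 2) * q y + k y * (p y * q y))
    (hqq : (fun y => fderiv ℝ q y (Pi.single 3 1 - q y • Pi.single 1 1)) =ᶠ[nhds x]
      fun y => -(y 1 * f y * (Real.sin (y 2) * Real.sin (y 2)))
        - Real.sin (y 2) * Real.cos (y 2) * p y + k y * (q y * q y)) :
    p x * (1 - F + x 1 * F' / 2) = 0 ∧ q x * (1 - F + x 1 * F' / 2) = 0 := by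
  have hp' := (hp.differentiableAt (by simp)).hasFDerivAt
  have hq' := (hq.differentiableAt (by simp)).hasFDerivAt
  have e1 := hpp.self_of_nhds
  have e2 := hqp.self_of_nhds
  have e3 := hpq.self_of_nhds
  have e4 := hqq.self_of_nhds
  beta_reduce at e1 e2 e3 e4
  -- The right-hand sides agree because the Christoffel symbols are symmetric; hence the two fields
  -- commute.
  have hcomm : fderiv ℝ q x (Pi.single 2 1 - p x • Pi.single 1 1) =
      fderiv ℝ p x (Pi.single 3 1 - q x • Pi.single 1 1) := by
    rw [e2, e3]
  have hr' := hasFDerivAt_coord (x := x) 1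
  have hcot := hasFDerivAt_cot hs
  have hss := hasFDerivAt_sin_mul_sin (x := x)
  have hsc := hasFDerivAt_sin_mul_cos (x := x)
  have d1 := ((hr'.fun_mul hf).fun_neg.fun_add (hk.fun_mul (hp'.fun_mul hp'))).fderiv
  have d2 := ((hcot.fun_mul hq').fun_add (hk.fun_mul (hp'.fun_mul hq'))).fderiv
  have d4 := ((((hr'.fun_mul hf).fun_mul hss).fun_neg.fun_sub (hsc.fun_mul hp')).fun_add
    (hk.fun_mul (hq'.fun_mul hq'))).fderiv
  -- The commutator on p yields the equation for q, and the commutator on q the equation for p. The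
  -- term K', which carries the second derivative of the metric function, cancels. The 1 in the
  -- final factor comes from cot' = -1 - cot².
  have c1 := fderiv_fderiv_comm (Pi.single 2 1) (Pi.single 3 1) (Pi.single 1 1) hp
    hp'.differentiableAt hq'.differentiableAt hcomm
  have c2 := fderiv_fderiv_comm (Pi.single 2 1) (Pi.single 3 1) (Pi.single 1 1) hq
    hp'.differentiableAt hq'.differentiableAt hcomm
  rw [hpp.fderiv_eq, hpq.fderiv_eq, d1, d2] at c1
  rw [hqp.fderiv_eq, hqq.fderiv_eq, d2, d4] at c2
  simp only [add_apply, smul_apply, neg_apply, sub_apply, smul_eq_mul, e1, e2, e3, e4,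
    ContinuousLinearMap.proj_apply, Pi.sub_apply, Pi.smul_apply, hfx] at c1 c2
  simp at c1 c2
  have hK : k x * x 1 * F = -2 * F - x 1 * F' / 2 := by
    rw [hkx]
    field_simp
  -- Writing cos θ = t sin θ makes both identities polynomial; the one from q carries an extra
  -- factor sin² θ.
  obtain ⟨t, ht⟩ : ∃ t, t = Real.cos (x 2) / Real.sin (x 2) := ⟨_, rfl⟩
  have htc : Real.cos (x 2) = t * Real.sin (x 2) := by
    rw [ht]
    field_simp
  rw [← ht] at c1 c2
  rw [htc] at c2
  constructor
  · apply mul_left_cancel₀ (pow_ne_zero 2 hs)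
    linear_combination -c2 - Real.sin (x 2) ^ 2 * p x * hK
  · linear_combination c1 - q x * hK

/-- Integrability conditions for a covector field `p` with `p_t = 1` and vanishing optical form. -/
lemma integrability_static {f h e z p q : Coord → ℝ}
    {F F' f' h' : ℝ} {x : Coord} (hr : x 1 ≠ 0) (hs : Real.sin (x 2) ≠ 0) (hF0 : F ≠ 0)
    (hfx : f x = F) (hex : e x = 1 / x 1 - F' / (2 * F))
    (hf : HasFDerivAt f (f' • (ContinuousLinearMap.proj 1 : Coord →L[ℝ] ℝ)) x)
    (hh : HasFDerivAt h (h' • (ContinuousLinearMap.proj 1 : Coord →L[ℝ] ℝ)) x)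
    (hz : DifferentiableAt ℝ z x) (hp : ContDiffAt ℝ 2 p x) (hq : ContDiffAt ℝ 2 q x)
    (hzp : fderiv ℝ z x (Pi.single 2 1 - p x • Pi.single 0 1) = p x * (e x + h x * (z x * z x)))
    (hzq : fderiv ℝ z x (Pi.single 3 1 - q x • Pi.single 0 1) = q x * (e x + h x * (z x * z x)))
    (hpp : (fun y => fderiv ℝ p y (Pi.single 2 1 - p y • Pi.single 0 1)) =ᶠ[nhds x]
      fun y => -(y 1 * f y * z y) + h y * z y * (p y * p y))
    (hqp : (fun y => fderiv ℝ q y (Pi.single 2 1 - p y • Pi.single 0 1)) =ᶠ[nhds x]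
      fun y => Real.cos (y 2) / Real.sin (y 2) * q y + h y * z y * (p y * q y))
    (hpq : (fun y => fderiv ℝ p y (Pi.single 3 1 - q y • Pi.single 0 1)) =ᶠ[nhds x]
      fun y => Real.cos (y 2) / Real.sin (y 2) * q y + h y * z y * (p y * q y))
    (hqq : (fun y => fderiv ℝ q y (Pi.single 3 1 - q y • Pi.single 0 1)) =ᶠ[nhds x]
      fun y => -(y 1 * f y * z y * (Real.sin (y 2) * Real.sin (y 2)))
        - Real.sin (y 2) * Real.cos (y 2) * p y + h y * z y * (q y * q y)) :
    p x * (1 - F + x 1 * F' / 2) = 0 ∧ q x * (1 - F + x 1 * F' / 2) = 0 := by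
  have hz' := hz.hasFDerivAt
  have hp' := (hp.differentiableAt (by simp)).hasFDerivAt
  have hq' := (hq.differentiableAt (by simp)).hasFDerivAt
  have e1 := hpp.self_of_nhds
  have e2 := hqp.self_of_nhds
  have e3 := hpq.self_of_nhds
  have e4 := hqq.self_of_nhds
  beta_reduce at e1 e2 e3 e4
  have hcomm : fderiv ℝ q x (Pi.single 2 1 - p x • Pi.single 0 1) =
      fderiv ℝ p x (Pi.single 3 1 - q x • Pi.single 0 1) := by
    rw [e2, e3]
  have hr' := hasFDerivAt_coord (x := x) 1
  have hcot := hasFDerivAt_cot hs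
  have hss := hasFDerivAt_sin_mul_sin (x := x)
  have hsc := hasFDerivAt_sin_mul_cos (x := x)
  have hrz := (hr'.fun_mul hf).fun_mul hz'
  have hhz := hh.fun_mul hz'
  have d1 := (hrz.fun_neg.fun_add (hhz.fun_mul (hp'.fun_mul hp'))).fderiv
  have d2 := ((hcot.fun_mul hq').fun_add (hhz.fun_mul (hp'.fun_mul hq'))).fderiv
  have d4 := (((hrz.fun_mul hss).fun_neg.fun_sub (hsc.fun_mul hp')).fun_add
    (hhz.fun_mul (hq'.fun_mul hq'))).fderiv
  -- Here the fields have no ∂_r component, so f' and h' drop out. The derivative F' enters only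
  -- through e, by way of the derivatives of z.
  have c1 := fderiv_fderiv_comm (Pi.single 2 1) (Pi.single 3 1) (Pi.single 0 1) hp
    hp'.differentiableAt hq'.differentiableAt hcomm
  have c2 := fderiv_fderiv_comm (Pi.single 2 1) (Pi.single 3 1) (Pi.single 0 1) hq
    hp'.differentiableAt hq'.differentiableAt hcomm
  rw [hpp.fderiv_eq, hpq.fderiv_eq, d1, d2] at c1
  rw [hqp.fderiv_eq, hqq.fderiv_eq, d2, d4] at c2
  simp only [add_apply, smul_apply, neg_apply, sub_apply, smul_eq_mul, e1, e2, e3, e4, hzp, hzq,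
    ContinuousLinearMap.proj_apply, Pi.sub_apply, Pi.smul_apply, hfx] at c1 c2
  simp at c1 c2
  have hE : x 1 * F * e x = F - x 1 * F' / 2 := by
    rw [hex]
    field_simp
  obtain ⟨t, ht⟩ : ∃ t, t = Real.cos (x 2) / Real.sin (x 2) := ⟨_, rfl⟩
  have htc : Real.cos (x 2) = t * Real.sin (x 2) := by
    rw [ht]
    field_simp
  rw [← ht] at c1 c2
  rw [htc] at c2
  constructor
  · apply mul_left_cancel₀ (pow_ne_zero 2 hs)
    linear_combination -c2 + Real.sin (x 2) ^ 2 * p x * hE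
  · linear_combination c1 + q x * hE

/-! ### The differential equations of a Kundt congruence -/

/-- The components of the dual covector field, normalized by the `n`-th one. -/
noncomputable def ratio (f : ℝ → ℝ) (l : Coord → Coord) (n a : Fin 4) (x : Coord) : ℝ :=
  lower f l a x / lower f l n x

lemma scalarProd_eq_sum_lower (f : ℝ → ℝ) (l : Coord → Coord) (x u : Coord) :
    scalarProd (standardMetric f) x u (l x) = ∑ a, u a * lower f l a x := by
  simp only [scalarProd_standard, Fin.sum_univ_four, lower, diagEntry]
  simp
  ring

lemma contDiffAt_lower {f : ℝ → ℝ} {l : Coord → Coord} {x : Coord}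
    (hf : ContDiffAt ℝ ∞ f (x 1)) (h0 : f (x 1) ≠ 0) (hl : ContDiffAt ℝ ∞ l x) (a : Fin 4) :
    ContDiffAt ℝ ∞ (lower f l a) x := by
  have hcoord : ∀ i, ContDiffAt ℝ ∞ (fun y : Coord => y i) x := fun i => by fun_prop
  have hf' : ContDiffAt ℝ ∞ (fun y : Coord => f (y 1)) x :=
    ContDiffAt.comp (f := fun y : Coord => y 1) x hf (hcoord 1)
  refine ContDiffAt.mul ?_ (contDiffAt_pi.1 hl a)
  fin_cases a
  · exact hf'.neg
  · exact contDiffAt_const.div hf' h0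
  · exact (hcoord 1).pow 2
  · exact ((hcoord 1).pow 2).mul ((Real.contDiff_sin.contDiffAt.comp x (hcoord 2)).pow 2)

/-- The vanishing of the optical form on `ℓ^⊥` as differential equations for the normalized dual
covector field. -/
lemma fderiv_ratio {f : ℝ → ℝ} {l : Coord → Coord} {x : Coord} {n : Fin 4}
    (hf : ContDiffAt ℝ ∞ f (x 1)) (h0 : f (x 1) ≠ 0) (hr : x 1 ≠ 0)
    (hs : Real.sin (x 2) ≠ 0) (hl : ContDiffAt ℝ ∞ l x) (hn : lower f l n x ≠ 0)
    (hopt : ∀ u v, scalarProd (standardMetric f) x u (l x) = 0 →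
      scalarProd (standardMetric f) x v (l x) = 0 →
      opticalForm (standardMetric f) l x u v = 0) (a b : Fin 4) :
    fderiv ℝ (ratio f l n a) x (Pi.single b 1 - ratio f l n b x • Pi.single n 1) =
      christoffelForm (f (x 1)) (deriv f (x 1)) (x 1) (Real.sin (x 2)) (Real.cos (x 2))
        (fun i => ratio f l n i x) (Pi.single b 1 - ratio f l n b x • Pi.single n 1)
        (Pi.single a 1 - ratio f l n a x • Pi.single n 1) := by
  -- These vectors are annihilated by the dual covector, so the optical form vanishes on them.
  have horth : ∀ b, scalarProd (standardMetric f) x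
      (Pi.single b 1 - ratio f l n b x • Pi.single n 1) (l x) = 0 := by
    intro b
    rw [scalarProd_eq_sum_lower]
    simp [sub_mul, Finset.sum_sub_distrib, ratio, Pi.single_apply, hn]
  have hd : ∀ a, DifferentiableAt ℝ (lower f l a) x := fun a =>
    (contDiffAt_lower hf h0 hl a).differentiableAt (by simp)
  have h := hopt _ _ (horth b) (horth a)
  rw [opticalForm_standardMetric (hf.differentiableAt (by simp)).hasDerivAt h0 hr hs
    (hl.differentiableAt (by simp))] at h
  have hratio : DifferentiableAt ℝ (ratio f l n a) x :=
    ((contDiffAt_lower hf h0 hl a).div (contDiffAt_lower hf h0 hl n) hn).differentiableAt (by simp)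
  have hmul : lower f l a =ᶠ[nhds x] fun y => ratio f l n a y * lower f l n y := by
    filter_upwards [(hd n).continuousAt.eventually_ne hn] with y hy
    rw [ratio, div_mul_cancel₀ _ hy]
  -- With ξ_a = p_a ξ_n, the combination dξ_a - p_a dξ_n equals ξ_n dp_a: the derivative of the
  -- normalizing component disappears. The Christoffel term is linear in ξ, so ξ_n can be cancelled
  -- throughout.
  have hder := hmul.fderiv_eq.trans (hratio.hasFDerivAt.fun_mul (hd n).hasFDerivAt).fderiv
  generalize Pi.single b 1 - ratio f l n b x • Pi.single n 1 = u at *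
  have hlow : ∀ i, lower f l i x = ratio f l n i x * lower f l n x := fun i => by
    rw [ratio, div_mul_cancel₀ _ hn]
  have hscale : christoffelForm (f (x 1)) (deriv f (x 1)) (x 1) (Real.sin (x 2)) (Real.cos (x 2))
        (fun i => lower f l i x) u (Pi.single a 1 - ratio f l n a x • Pi.single n 1) =
      lower f l n x * christoffelForm (f (x 1)) (deriv f (x 1)) (x 1) (Real.sin (x 2))
        (Real.cos (x 2)) (fun i => ratio f l n i x) u
        (Pi.single a 1 - ratio f l n a x • Pi.single n 1) := by
    simp only [christoffelForm, hlow 0, hlow 1, hlow 2, hlow 3]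
    ring
  rw [hscale] at h
  simp only [Pi.sub_apply, Pi.smul_apply, Pi.single_apply, sub_mul, Finset.sum_sub_distrib] at h
  simp at h
  rw [hder] at h
  apply mul_left_cancel₀ hn
  simp only [add_apply, smul_apply, smul_eq_mul] at h
  linear_combination h

lemma exists_hasFDerivAt_comp_radius {h : ℝ → ℝ} {x : Coord} (hh : DifferentiableAt ℝ h (x 1)) :
    ∃ h' : ℝ, HasFDerivAt (fun y : Coord => h (y 1))
      (h' • (ContinuousLinearMap.proj 1 : Coord →L[ℝ] ℝ)) x :=
  ⟨_, hasFDerivAt_comp_coord 1 hh.hasDerivAt⟩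

section

variable {f : ℝ → ℝ} {M : Set Coord} {l : Coord → Coord}

/-- The normalized dual covector of a Kundt congruence satisfies the equation for `f` wherever it
is not radial. -/
lemma ratio_mul_eq_zero (hM : IsOpen M) (hr : ∀ x ∈ M, x 1 ≠ 0)
    (hs : ∀ x ∈ M, Real.sin (x 2) ≠ 0) (hf : ∀ x ∈ M, ContDiffAt ℝ ∞ f (x 1))
    (h0 : ∀ x ∈ M, f (x 1) ≠ 0) (hK : IsKundtCongruence (standardMetric f) M l)
    {n : Fin 4} (hn : n = 0 ∨ n = 1) {x : Coord} (hx : x ∈ M) (hxn : lower f l n x ≠ 0) :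
    (ratio f l n 2 x * (1 - f (x 1) + x 1 * deriv f (x 1) / 2) = 0 ∧
      ratio f l n 3 x * (1 - f (x 1) + x 1 * deriv f (x 1) / 2) = 0) ∧
    ¬ ((∀ᶠ y in nhds x, ratio f l n 2 y = 0) ∧ ∀ᶠ y in nhds x, ratio f l n 3 y = 0) := by
  have hl : ∀ y ∈ M, ContDiffAt ℝ ∞ l y := fun y hy => hK.smooth.contDiffAt (hM.mem_nhds hy)
  have hlow : ∀ a, ∀ y ∈ M, ContDiffAt ℝ ∞ (lower f l a) y := fun a y hy =>
    contDiffAt_lower (hf y hy) (h0 y hy) (hl y hy) a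
  have hev : ∀ᶠ y in nhds x, y ∈ M ∧ lower f l n y ≠ 0 :=
    (hM.eventually_mem hx).and ((hlow n x hx).continuousAt.eventually_ne hxn)
  have hD : ∀ᶠ y in nhds x, ratio f l n n y = 1 ∧ ∀ a b,
      fderiv ℝ (ratio f l n a) y (Pi.single b 1 - ratio f l n b y • Pi.single n 1) =
        christoffelForm (f (y 1)) (deriv f (y 1)) (y 1) (Real.sin (y 2)) (Real.cos (y 2))
          (fun i => ratio f l n i y) (Pi.single b 1 - ratio f l n b y • Pi.single n 1)
          (Pi.single a 1 - ratio f l n a y • Pi.single n 1) := by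
    filter_upwards [hev] with y ⟨hy, hyn⟩
    exact ⟨div_self hyn, fderiv_ratio (hf y hy) (h0 y hy) (hr y hy) (hs y hy) (hl y hy) hyn
      fun u v hu hv => hK.opticalForm_eq_zero hM hy ((hf y hy).differentiableAt (by simp))
        (h0 y hy) (hr y hy) (hs y hy) hu hv⟩
  have hsmooth : ∀ a, ContDiffAt ℝ 2 (ratio f l n a) x := fun a =>
    contDiffAt_infty.1 ((hlow a x hx).div (hlow n x hx) hxn) 2
  have hf1 : DifferentiableAt ℝ f (x 1) := (hf x hx).differentiableAt (by simp)
  have hf2 : DifferentiableAt ℝ (deriv f) (x 1) :=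
    ((hf x hx).derivWithin (m := ∞) le_rfl).differentiableAt (by simp)
  have hrx := hr x hx
  have hsx := hs x hx
  have h0x := h0 x hx
  have hff := hasFDerivAt_comp_coord 1 hf1.hasDerivAt
  rcases hn with rfl | rfl
  · obtain ⟨h', hh⟩ := exists_hasFDerivAt_comp_radius (x := x)
      (h := fun r => f r * deriv f r / 2) (by fun_prop)
    refine ⟨integrability_static (e := fun y => 1 / y 1 - deriv f (y 1) / (2 * f (y 1)))
      (z := ratio f l 0 1) hrx hsx h0x rfl rfl hff hh ((hsmooth 1).differentiableAt (by simp))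
      (hsmooth 2) (hsmooth 3) ?_ ?_ ?_ ?_ ?_ ?_, ?_⟩
    · rw [hD.self_of_nhds.2 1 2]
      simp [christoffelForm, hD.self_of_nhds.1]
      ring
    · rw [hD.self_of_nhds.2 1 3]
      simp [christoffelForm, hD.self_of_nhds.1]
      ring
    · filter_upwards [hD] with y hy
      rw [hy.2 2 2]
      simp [christoffelForm, hy.1]
      ring
    · filter_upwards [hD] with y hy
      rw [hy.2 3 2]
      simp [christoffelForm, hy.1]
      ring
    · filter_upwards [hD] with y hy
      rw [hy.2 2 3]
      simp [christoffelForm, hy.1]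
      ring
    · filter_upwards [hD] with y hy
      rw [hy.2 3 3]
      simp [christoffelForm, hy.1]
      ring
    · rintro ⟨h2, h3⟩
      have hzero : ratio f l 0 2 =ᶠ[nhds x] fun _ => 0 := h2
      have h := hD.self_of_nhds.2 2 2
      rw [hzero.fderiv_eq] at h
      have h1 : ratio f l 0 1 x = 0 := by
        simpa [christoffelForm, h2.self_of_nhds, h3.self_of_nhds, hrx, h0x] using h
      have h1 : l x 1 = 0 := by
        simpa [lower, diagEntry, h0x] using (div_eq_zero_iff.1 h1).resolve_right hxn
      have h2 : l x 2 = 0 := by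
        simpa [lower, diagEntry, hrx] using
          (div_eq_zero_iff.1 h2.self_of_nhds).resolve_right hxn
      have h3 : l x 3 = 0 := by
        simpa [lower, diagEntry, hrx, hsx] using
          (div_eq_zero_iff.1 h3.self_of_nhds).resolve_right hxn
      have := hK.null x hx
      simp [scalarProd_standard, h1, h2, h3, h0x] at this
      exact hxn (by simp [lower, this])
  · obtain ⟨k', hk⟩ := exists_hasFDerivAt_comp_radius (x := x)
      (h := fun r => -2 / r - deriv f r / (2 * f r)) (by fun_prop (disch := simp [*]))
    refine ⟨integrability_radial hrx hsx h0x rfl rfl hff hk (hsmooth 2) (hsmooth 3)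
      ?_ ?_ ?_ ?_, ?_⟩
    · filter_upwards [hD] with y hy
      rw [hy.2 2 2]
      simp [christoffelForm, hy.1]
      ring
    · filter_upwards [hD] with y hy
      rw [hy.2 3 2]
      simp [christoffelForm, hy.1]
      ring
    · filter_upwards [hD] with y hy
      rw [hy.2 2 3]
      simp [christoffelForm, hy.1]
      ring
    · filter_upwards [hD] with y hy
      rw [hy.2 3 3]
      simp [christoffelForm, hy.1]
      ring
    · rintro ⟨h2, -⟩
      have hzero : ratio f l 1 2 =ᶠ[nhds x] fun _ => 0 := h2
      have h := hD.self_of_nhds.2 2 2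
      rw [hzero.fderiv_eq] at h
      simp [christoffelForm, h2.self_of_nhds, hD.self_of_nhds.1, hrx, h0x] at h

/-- A Kundt congruence forces `r f' = 2 (f - 1)`. -/
lemma IsKundtCongruence.deriv_eq (hM : IsOpen M) (hr : ∀ x ∈ M, x 1 ≠ 0)
    (hs : ∀ x ∈ M, Real.sin (x 2) ≠ 0) (hf : ∀ x ∈ M, ContDiffAt ℝ ∞ f (x 1))
    (h0 : ∀ x ∈ M, f (x 1) ≠ 0) (hK : IsKundtCongruence (standardMetric f) M l)
    {x : Coord} (hx : x ∈ M) : 1 - f (x 1) + x 1 * deriv f (x 1) / 2 = 0 := by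
  -- A null vector with no t or r component is zero, since the metric is positive definite on the
  -- spheres whatever the sign of f.
  obtain ⟨n, hn, hxn⟩ : ∃ n : Fin 4, (n = 0 ∨ n = 1) ∧ lower f l n x ≠ 0 := by
    by_contra! h
    have ht : l x 0 = 0 := by simpa [lower, diagEntry, h0 x hx] using h 0 (by simp)
    have hrad : l x 1 = 0 := by simpa [lower, diagEntry, h0 x hx] using h 1 (by simp)
    have hnull := hK.null x hx
    have hrx := hr x hx
    have hsx := hs x hx
    simp only [scalarProd_standard, ht, hrad] at hnull
    have h2 : l x 2 = 0 := by
      by_contra h2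
      have : 0 < x 1 ^ 2 * (l x 2) ^ 2 := by positivity
      nlinarith [sq_nonneg (x 1 * Real.sin (x 2) * l x 3)]
    have h3 : l x 3 = 0 := by
      by_contra h3
      have : 0 < x 1 ^ 2 * Real.sin (x 2) ^ 2 * (l x 3) ^ 2 := by positivity
      nlinarith [sq_nonneg (x 1 * l x 2)]
    exact hK.ne_zero x hx (by ext i; fin_cases i <;> assumption)
  by_contra hne
  have hl : ContDiffAt ℝ ∞ l x := hK.smooth.contDiffAt (hM.mem_nhds hx)
  have hcont : ContinuousAt (fun y : Coord => 1 - f (y 1) + y 1 * deriv f (y 1) / 2) x := by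
    have hf1 : ContinuousAt f (x 1) := (hf x hx).continuousAt
    have hf2 : ContinuousAt (deriv f) (x 1) := 
      ((hf x hx).derivWithin (m := ∞) le_rfl).continuousAt
    have hc : ContinuousAt (fun y : Coord => y 1) x := continuousAt_apply 1 x
    exact (continuousAt_const.sub (ContinuousAt.comp (f := fun y : Coord => y 1) hf1 hc)).add
      ((hc.mul (ContinuousAt.comp (f := fun y : Coord => y 1) hf2 hc)).div_const 2)
  -- By continuity the factor stays nonzero near x, so both angular ratios vanish on a
  -- neighbourhood.
  have hev : ∀ᶠ y in nhds x, y ∈ M ∧ lower f l n y ≠ 0 ∧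
      1 - f (y 1) + y 1 * deriv f (y 1) / 2 ≠ 0 :=
    (hM.eventually_mem hx).and (((contDiffAt_lower (hf x hx) (h0 x hx) hl
      n).continuousAt.eventually_ne hxn).and (hcont.eventually_ne hne))
  refine (ratio_mul_eq_zero hM hr hs hf h0 hK hn hx hxn).2 ⟨?_, ?_⟩
  · filter_upwards [hev] with y ⟨hy, hyn, hyne⟩
    exact (mul_eq_zero.1 (ratio_mul_eq_zero hM hr hs hf h0 hK hn hy hyn).1.1).resolve_right hyne
  · filter_upwards [hev] with y ⟨hy, hyn, hyne⟩
    exact (mul_eq_zero.1 (ratio_mul_eq_zero hM hr hs hf h0 hK hn hy hyn).1.2).resolve_right hyne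

end

/-! ### Solving for f, and the curvature -/

/-- The differential equation says exactly that (1 - f)/r² has zero derivative; k is its constant
value. -/
lemma exists_eq_one_sub_mul_sq {f : ℝ → ℝ} {S : Set ℝ} (hS : IsOpen S) (hc : IsPreconnected S)
    (hpos : ∀ r ∈ S, r ≠ 0) (hf : ∀ r ∈ S, DifferentiableAt ℝ f r)
    (hode : ∀ r ∈ S, 1 - f r + r * deriv f r / 2 = 0) :
    ∃ k : ℝ, ∀ r ∈ S, f r = 1 - k * r ^ 2 := by
  have hd : ∀ r ∈ S, HasDerivAt (fun r => (1 - f r) / r ^ 2) 0 r := by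
    intro r hr
    have h0 := hpos r hr
    refine (((hf r hr).hasDerivAt.const_sub 1).fun_div (hasDerivAt_pow 2 r)
      (pow_ne_zero 2 h0)).congr_deriv ?_
    field_simp
    linear_combination -2 * r * hode r hr
  obtain ⟨k, hk⟩ := hS.exists_is_const_of_deriv_eq_zero hc
    (fun r hr => (hd r hr).differentiableAt.differentiableWithinAt) (fun r hr => (hd r hr).deriv)
  refine ⟨k, fun r hr => ?_⟩
  have h0 := hpos r hr
  rw [← hk r hr]
  field_simp
  ring

/-- The derivatives of the radial factors `christoffelR` for `f r = 1 - k r²`. -/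
noncomputable def christoffelRDeriv (k F r : ℝ) : Fin 4 → Fin 4 → Fin 4 → ℝ :=
  ![![![0, -k / F - 2 * k ^ 2 * r ^ 2 / F ^ 2, 0, 0],
      ![-k / F - 2 * k ^ 2 * r ^ 2 / F ^ 2, 0, 0, 0], 0, 0],
    ![![-k * F + 2 * k ^ 2 * r ^ 2, 0, 0, 0], ![0, k / F + 2 * k ^ 2 * r ^ 2 / F ^ 2, 0, 0],
      ![0, 0, -F + 2 * k * r ^ 2, 0], ![0, 0, 0, -F + 2 * k * r ^ 2]],
    ![0, ![0, 0, -1 / r ^ 2, 0], ![0, -1 / r ^ 2, 0, 0], 0],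
    ![0, ![0, 0, 0, -1 / r ^ 2], 0, ![0, -1 / r ^ 2, 0, 0]]]

/-- The derivatives of the angular factors `christoffelTheta`. -/
noncomputable def christoffelThetaDeriv (s c : ℝ) : Fin 4 → Fin 4 → Fin 4 → ℝ :=
  ![0, ![0, 0, 0, ![0, 0, 0, 2 * s * c]], ![0, 0, 0, ![0, 0, 0, s ^ 2 - c ^ 2]],
    ![0, 0, ![0, 0, 0, -1 - (c / s) ^ 2], ![0, 0, -1 - (c / s) ^ 2, 0]]]

lemma hasDerivAt_christoffelR {k r : ℝ} (hr : r ≠ 0) (hF : 1 - k * r ^ 2 ≠ 0) (a b c : Fin 4) :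
    HasDerivAt (fun r => christoffelR (1 - k * r ^ 2) (-2 * k * r) r a b c)
      (christoffelRDeriv k (1 - k * r ^ 2) r a b c) r := by
  have hf : HasDerivAt (fun r : ℝ => 1 - k * r ^ 2) (-2 * k * r) r :=
    (((hasDerivAt_pow 2 r).const_mul k).const_sub 1).congr_deriv (by simp; ring)
  have hf' : HasDerivAt (fun r : ℝ => -2 * k * r) (-2 * k) r := by
    simpa using (hasDerivAt_id r).const_mul (-2 * k)
  have hq : HasDerivAt (fun r : ℝ => -2 * k * r / (2 * (1 - k * r ^ 2)))
      (-k / (1 - k * r ^ 2) - 2 * k ^ 2 * r ^ 2 / (1 - k * r ^ 2) ^ 2) r := by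
    refine (hf'.fun_div (hf.const_mul 2) (mul_ne_zero two_ne_zero hF)).congr_deriv ?_
    field_simp
  have hq' : HasDerivAt (fun r : ℝ => -(-2 * k * r) / (2 * (1 - k * r ^ 2)))
      (k / (1 - k * r ^ 2) + 2 * k ^ 2 * r ^ 2 / (1 - k * r ^ 2) ^ 2) r := by
    simp only [neg_div]
    exact hq.fun_neg.congr_deriv (by ring)
  have hp : HasDerivAt (fun r : ℝ => (1 - k * r ^ 2) * (-2 * k * r) / 2)
      (-k * (1 - k * r ^ 2) + 2 * k ^ 2 * r ^ 2) r :=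
    ((hf.fun_mul hf').div_const 2).congr_deriv (by ring)
  have hrf : HasDerivAt (fun r : ℝ => -(r * (1 - k * r ^ 2)))
      (-(1 - k * r ^ 2) + 2 * k * r ^ 2) r :=
    ((hasDerivAt_id' r).fun_mul hf).fun_neg.congr_deriv (by ring)
  have hi : HasDerivAt (fun r : ℝ => 1 / r) (-1 / r ^ 2) r := by
    simpa [neg_div] using hasDerivAt_inv hr
  have h0 : HasDerivAt (fun _ : ℝ => (0 : ℝ)) 0 r := hasDerivAt_const r 0
  have h1 : HasDerivAt (fun _ : ℝ => (1 : ℝ)) 0 r := hasDerivAt_const r 1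
  fin_cases a <;> fin_cases b <;> fin_cases c <;>
    first | exact h0 | exact h1 | exact hi | exact hrf | exact hq | exact hq' | exact hp

lemma hasDerivAt_christoffelTheta {θ : ℝ} (hs : Real.sin θ ≠ 0) (a b c : Fin 4) :
    HasDerivAt (fun θ => christoffelTheta (Real.sin θ) (Real.cos θ) a b c)
      (christoffelThetaDeriv (Real.sin θ) (Real.cos θ) a b c) θ := by
  have hsin := Real.hasDerivAt_sin θ
  have hcos := Real.hasDerivAt_cos θ
  have hss : HasDerivAt (fun θ => Real.sin θ ^ 2) (2 * Real.sin θ * Real.cos θ) θ := by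
    simpa using hsin.fun_pow 2
  have hsc : HasDerivAt (fun θ => -(Real.sin θ * Real.cos θ))
      (Real.sin θ ^ 2 - Real.cos θ ^ 2) θ :=
    (hsin.fun_mul hcos).fun_neg.congr_deriv (by ring)
  have hcot : HasDerivAt (fun θ => Real.cos θ / Real.sin θ)
      (-1 - (Real.cos θ / Real.sin θ) ^ 2) θ :=
    (hcos.fun_div hsin hs).congr_deriv (by field_simp)
  have h1 : HasDerivAt (fun _ : ℝ => (1 : ℝ)) 0 θ := hasDerivAt_const θ 1
  fin_cases a <;> fin_cases b <;> fin_cases c <;>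
    first | exact h1 | exact hss | exact hsc | exact hcot

section

variable {f : ℝ → ℝ} {k : ℝ} {M : Set Coord}

lemma hasDerivAt_of_eq_one_sub_mul_sq (hM : IsOpen M)
    (hf : ∀ x ∈ M, f (x 1) = 1 - k * x 1 ^ 2) {x : Coord} (hx : x ∈ M) :
    HasDerivAt f (-2 * k * x 1) (x 1) := by
  -- The values of r on M form an open set, so the formula for f holds near `x 1` and may be
  -- differentiated.
  have hev : f =ᶠ[nhds (x 1)] fun r => 1 - k * r ^ 2 := by
    filter_upwards [((isOpenMap_eval 1) M hM).mem_nhds ⟨x, hx, rfl⟩]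
    rintro _ ⟨y, hy, rfl⟩
    exact hf y hy
  refine HasDerivAt.congr_of_eventuallyEq ?_ hev
  exact (((hasDerivAt_pow 2 (x 1)).const_mul k).const_sub 1).congr_deriv (by simp; ring)

lemma partialDeriv_christoffel (hM : IsOpen M) (hr : ∀ x ∈ M, x 1 ≠ 0)
    (hs : ∀ x ∈ M, Real.sin (x 2) ≠ 0) (h0 : ∀ x ∈ M, f (x 1) ≠ 0)
    (hf : ∀ x ∈ M, f (x 1) = 1 - k * x 1 ^ 2) {x : Coord} (hx : x ∈ M) (a b c d : Fin 4) :
    partialDeriv d (christoffel (standardMetric f) a b c) x =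
      christoffelRDeriv k (1 - k * x 1 ^ 2) (x 1) a b c
          * christoffelTheta (Real.sin (x 2)) (Real.cos (x 2)) a b c * (if d = 1 then 1 else 0)
        + christoffelR (1 - k * x 1 ^ 2) (-2 * k * x 1) (x 1) a b c
          * christoffelThetaDeriv (Real.sin (x 2)) (Real.cos (x 2)) a b c
          * (if d = 2 then 1 else 0) := by
  have hev : christoffel (standardMetric f) a b c =ᶠ[nhds x] fun y =>
      christoffelR (1 - k * y 1 ^ 2) (-2 * k * y 1) (y 1) a b c
        * christoffelTheta (Real.sin (y 2)) (Real.cos (y 2)) a b c := by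
    filter_upwards [hM.mem_nhds hx] with y hy
    rw [christoffel_standardMetric (hasDerivAt_of_eq_one_sub_mul_sq hM hf hy) (h0 y hy) (hr y hy)
      (hs y hy), hf y hy]
  have hF : 1 - k * x 1 ^ 2 ≠ 0 := hf x hx ▸ h0 x hx
  rw [partialDeriv, hev.fderiv_eq, (hasFDerivAt_mul_coord
    (hasDerivAt_christoffelR (hr x hx) hF a b c)
    (hasDerivAt_christoffelTheta (hs x hx) a b c)).fderiv]
  simp [Pi.single_apply, eq_comm]

lemma riemann_swap (g : Metric) (a b c d : Fin 4) (x : Coord) :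
    riemann g a b c d x = -riemann g a b d c x := by
  simp only [riemann, Finset.sum_sub_distrib]
  ring

-- Antisymmetry in the last two indices leaves c < d, and every remaining component is a rational
-- identity.
set_option maxHeartbeats 1000000 in
lemma hasConstantCurvature (hM : IsOpen M) (hr : ∀ x ∈ M, x 1 ≠ 0)
    (hs : ∀ x ∈ M, Real.sin (x 2) ≠ 0) (h0 : ∀ x ∈ M, f (x 1) ≠ 0)
    (hf : ∀ x ∈ M, f (x 1) = 1 - k * x 1 ^ 2) :
    HasConstantCurvature (standardMetric f) M k := by
  suffices h : ∀ x ∈ M, ∀ c d : Fin 4, c < d → ∀ a b : Fin 4, riemann (standardMetric f) a b c d x =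
      k * ((if a = c then standardMetric f x b d else 0)
        - (if a = d then standardMetric f x b c else 0)) by
    intro x hx a b c d
    rcases lt_trichotomy c d with hcd | rfl | hcd
    · exact h x hx c d hcd a b
    · linarith [riemann_swap (standardMetric f) a b c c x]
    · rw [riemann_swap, h x hx d c hcd a b]
      ring
  intro x hx c d hcd a b
  have hrx := hr x hx
  have hsx := hs x hx
  have hF : 1 - k * x 1 ^ 2 ≠ 0 := hf x hx ▸ h0 x hx
  simp only [riemann, partialDeriv_christoffel hM hr hs h0 hf hx,
    christoffel_standardMetric (hasDerivAt_of_eq_one_sub_mul_sq hM hf hx) (h0 x hx) hrx hsx,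
    standardMetric_apply, diagEntry, hf x hx, Fin.sum_univ_four]
  obtain ⟨F, hFe⟩ : ∃ F, F = 1 - k * x 1 ^ 2 := ⟨_, rfl⟩
  have hk : k * x 1 ^ 2 = 1 - F := by rw [hFe]; ring
  rw [← hFe] at hF ⊢
  -- Sine and cosine may become independent variables: sin² + cos² = 1 has already been used in
  -- writing cot' as -1 - cot².
  generalize Real.sin (x 2) = s at *
  generalize Real.cos (x 2) = t at *
  generalize x 1 = r at *
  -- Eliminating k in favour of F leaves only the denominators F, r and s, all nonzero.
  have hk' : k = (1 - F) / r ^ 2 := by rw [← hk]; field_simp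
  clear hk hFe
  subst hk'
  fin_cases c <;> fin_cases d <;> try exact absurd hcd (by decide)
  all_goals clear hcd
  all_goals fin_cases a <;> fin_cases b <;>
    simp [christoffelR, christoffelTheta, christoffelRDeriv, christoffelThetaDeriv] <;>
    field_simp <;> ring

end

/-! ### Local isometries onto the model spaces -/

/-- The Cartesian coordinates of the point with polar coordinates `r`, `θ`, `φ`. -/
noncomputable def cartesian (i : Fin 3) (x : Coord) : ℝ :=
  (![x 1 * Real.sin (x 2) * Real.cos (x 3), x 1 * Real.sin (x 2) * Real.sin (x 3),
    x 1 * Real.cos (x 2)] : Fin 3 → ℝ) i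

lemma contDiff_cartesian (i : Fin 3) : ContDiff ℝ ∞ (cartesian i) := by
  have hcoord : ∀ i, ContDiff ℝ ∞ (fun y : Coord => y i) := fun i => by fun_prop
  have hs : ∀ i, ContDiff ℝ ∞ (fun y : Coord => Real.sin (y i)) := fun i =>
    Real.contDiff_sin.comp (hcoord i)
  have hc : ∀ i, ContDiff ℝ ∞ (fun y : Coord => Real.cos (y i)) := fun i =>
    Real.contDiff_cos.comp (hcoord i)
  fin_cases i
  · exact ((hcoord 1).mul (hs 2)).mul (hc 3)
  · exact ((hcoord 1).mul (hs 2)).mul (hs 3)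
  · exact (hcoord 1).mul (hc 2)

lemma sum_cartesian_sq (x : Coord) :
    cartesian 0 x ^ 2 + cartesian 1 x ^ 2 + cartesian 2 x ^ 2 = x 1 ^ 2 := by
  simp only [cartesian, Matrix.cons_val]
  linear_combination (x 1 * Real.sin (x 2)) ^ 2 * Real.sin_sq_add_cos_sq (x 3)
    + x 1 ^ 2 * Real.sin_sq_add_cos_sq (x 2)

/-- This is the Euclidean metric in spherical coordinates; the flat factor of each model contributes
it. -/
lemma sum_fderiv_cartesian (x u v : Coord) :
    fderiv ℝ (cartesian 0) x u * fderiv ℝ (cartesian 0) x v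
      + fderiv ℝ (cartesian 1) x u * fderiv ℝ (cartesian 1) x v
      + fderiv ℝ (cartesian 2) x u * fderiv ℝ (cartesian 2) x v =
    u 1 * v 1 + x 1 ^ 2 * u 2 * v 2 + x 1 ^ 2 * Real.sin (x 2) ^ 2 * u 3 * v 3 := by
  have hr := hasFDerivAt_coord (x := x) 1
  have hs := fun i => hasFDerivAt_comp_coord i (Real.hasDerivAt_sin (x i))
  have hc := fun i => hasFDerivAt_comp_coord i (Real.hasDerivAt_cos (x i))
  have h0 : HasFDerivAt (cartesian 0) _ x := (hr.fun_mul (hs 2)).fun_mul (hc 3)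
  have h1 : HasFDerivAt (cartesian 1) _ x := (hr.fun_mul (hs 2)).fun_mul (hs 3)
  have h2 : HasFDerivAt (cartesian 2) _ x := hr.fun_mul (hc 2)
  rw [h0.fderiv, h1.fderiv, h2.fderiv]
  simp only [add_apply, smul_apply, smul_eq_mul, ContinuousLinearMap.proj_apply]
  linear_combination
    ((Real.sin (x 2) * u 1 + x 1 * Real.cos (x 2) * u 2)
        * (Real.sin (x 2) * v 1 + x 1 * Real.cos (x 2) * v 2)
      + x 1 ^ 2 * Real.sin (x 2) ^ 2 * u 3 * v 3) * Real.sin_sq_add_cos_sq (x 3)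
    + (u 1 * v 1 + x 1 ^ 2 * u 2 * v 2) * Real.sin_sq_add_cos_sq (x 2)

section

variable {f : ℝ → ℝ} {k : ℝ} {M : Set Coord}

/-- The embedding of the static chart in a quadric: `(A(t), B(t))` runs through a conic with
constant speed, and is scaled by `√(q f)`. -/
noncomputable def staticEmbedding (f A B : ℝ → ℝ) (q : ℝ) (x : Coord) : Fin 5 → ℝ :=
  ![Real.sqrt (q * f (x 1)) * A (x 0), Real.sqrt (q * f (x 1)) * B (x 0),
    cartesian 0 x, cartesian 1 x, cartesian 2 x]

/-- Put σ = √(q f). The image satisfies m q f + r² = 1/k because m q k = 1 and f = 1 - k r². The dt²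
coefficient is m' q f = -f, the dt dr term vanishes by `hmix`, and the dr² coefficient is matched by
m σ'² + 1 = 1/f. Leaving q and the conic free covers both signs of f and of k. -/
lemma isLocalIsometry_staticEmbedding {A B A' B' : ℝ → ℝ} {q m m' ε₀ ε₁ c : ℝ}
    (hM : IsOpen M) (hf : ∀ x ∈ M, f (x 1) = 1 - k * x 1 ^ 2) (hq : ∀ x ∈ M, 0 < q * f (x 1))
    (hA : ContDiff ℝ ∞ A) (hB : ContDiff ℝ ∞ B) (hA' : ∀ t, HasDerivAt A (A' t) t)
    (hB' : ∀ t, HasDerivAt B (B' t) t) (hm : ∀ t, ε₀ * A t ^ 2 + ε₁ * B t ^ 2 = m)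
    (hmix : ∀ t, ε₀ * A t * A' t + ε₁ * B t * B' t = 0)
    (hm' : ∀ t, ε₀ * A' t ^ 2 + ε₁ * B' t ^ 2 = m') (h1 : m * q * k = 1) (h2 : m' * q = -1)
    (hc : c * k = 1) :
    IsLocalIsometry (standardMetric f) M ![ε₀, ε₁, 1, 1, 1]
      {X | flatProd ![ε₀, ε₁, 1, 1, 1] X X = c} (staticEmbedding f A B q) := by
  have hfd : ∀ x ∈ M, HasDerivAt f (-2 * k * x 1) (x 1) := fun x hx =>
    hasDerivAt_of_eq_one_sub_mul_sq hM hf hx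
  have hcoord : ∀ i, ContDiff ℝ ∞ (fun y : Coord => y i) := fun i => by fun_prop
  have hsqrt : ContDiffOn ℝ ∞ (fun y : Coord => Real.sqrt (q * f (y 1))) M := by
    have : ContDiffOn ℝ ∞ (fun y : Coord => Real.sqrt (q * (1 - k * y 1 ^ 2))) M :=
      ContDiffOn.sqrt (by fun_prop) fun x hx => by rw [← hf x hx]; exact (hq x hx).ne'
    exact this.congr fun x hx => by rw [hf x hx]
  refine ⟨?_, ?_, ?_⟩
  · rw [contDiffOn_pi]
    intro i
    fin_cases i
    · exact hsqrt.mul (hA.comp (hcoord 0)).contDiffOn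
    · exact hsqrt.mul (hB.comp (hcoord 0)).contDiffOn
    · exact (contDiff_cartesian 0).contDiffOn
    · exact (contDiff_cartesian 1).contDiffOn
    · exact (contDiff_cartesian 2).contDiffOn
  · intro x hx
    have hs := Real.sq_sqrt (hq x hx).le
    have hcart := sum_cartesian_sq x
    have hk : k ≠ 0 := right_ne_zero_of_mul_eq_one hc
    simp only [Set.mem_ofPred_eq, flatProd, Fin.sum_univ_five, staticEmbedding, Matrix.cons_val]
    apply mul_right_cancel₀ hk
    linear_combination k * hcart + k * Real.sqrt (q * f (x 1)) ^ 2 * hm (x 0) + k * m * hs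
      + f (x 1) * h1 - hc + hf x hx
  · intro x hx u v
    obtain ⟨σ, hσ⟩ : ∃ σ, σ = Real.sqrt (q * f (x 1)) := ⟨_, rfl⟩
    have hσ2 : σ ^ 2 = q * f (x 1) := by rw [hσ]; exact Real.sq_sqrt (hq x hx).le
    have hσ0 : σ ≠ 0 := by rw [hσ]; exact (Real.sqrt_pos.2 (hq x hx)).ne'
    have hF0 : f (x 1) ≠ 0 := right_ne_zero_of_mul (hq x hx).ne'
    have hrad : HasFDerivAt (fun y : Coord => Real.sqrt (q * f (y 1)))
        ((-q * k * x 1 / σ) • (ContinuousLinearMap.proj 1 : Coord →L[ℝ] ℝ)) x := by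
      refine hasFDerivAt_comp_coord (h := fun r => Real.sqrt (q * f r)) 1 ?_
      refine (((hfd x hx).const_mul q).sqrt (hq x hx).ne').congr_deriv ?_
      rw [← hσ]
      field_simp
    have hcart := fun i => ((contDiff_cartesian i).differentiable (by simp) x).hasFDerivAt
    have hd : HasFDerivAt (staticEmbedding f A B q) (ContinuousLinearMap.pi
        ![Real.sqrt (q * f (x 1)) • A' (x 0) • ContinuousLinearMap.proj 0
            + A (x 0) • (-q * k * x 1 / σ) • ContinuousLinearMap.proj 1,
          Real.sqrt (q * f (x 1)) • B' (x 0) • ContinuousLinearMap.proj 0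
            + B (x 0) • (-q * k * x 1 / σ) • ContinuousLinearMap.proj 1,
          fderiv ℝ (cartesian 0) x, fderiv ℝ (cartesian 1) x, fderiv ℝ (cartesian 2) x])
        x := by
      rw [hasFDerivAt_pi]
      intro i
      fin_cases i
      · exact hrad.fun_mul (hasFDerivAt_comp_coord 0 (hA' (x 0)))
      · exact hrad.fun_mul (hasFDerivAt_comp_coord 0 (hB' (x 0)))
      · exact hcart 0
      · exact hcart 1
      · exact hcart 2
    -- Since σ' = -q k r/σ and m q k = 1, the left side is k r²/f + 1.
    have hρ : m * (-q * k * x 1 / σ) ^ 2 + 1 = 1 / f (x 1) := by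
      have hq0 : q ≠ 0 := left_ne_zero_of_mul (hq x hx).ne'
      rw [div_pow, hσ2]
      field_simp
      linear_combination hf x hx + k * x 1 ^ 2 * h1
    have hsph := sum_fderiv_cartesian x u v
    rw [hd.fderiv, scalarProd_standard]
    simp only [flatProd, Fin.sum_univ_five, ContinuousLinearMap.coe_pi', Matrix.cons_val,
      add_apply, smul_apply, smul_eq_mul, ContinuousLinearMap.proj_apply, ← hσ]
    linear_combination hsph + σ ^ 2 * u 0 * v 0 * hm' (x 0)
      + σ * (-q * k * x 1 / σ) * (u 0 * v 1 + u 1 * v 0) * hmix (x 0)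
      + (-q * k * x 1 / σ) ^ 2 * u 1 * v 1 * hm (x 0) + u 1 * v 1 * hρ
      + m' * u 0 * v 0 * hσ2 + f (x 1) * u 0 * v 0 * h2

lemma isLocallyDeSitter (hM : IsOpen M) (hMc : IsPreconnected M)
    (hf : ∀ x ∈ M, f (x 1) = 1 - k * x 1 ^ 2) (h0 : ∀ x ∈ M, f (x 1) ≠ 0) (hk : 0 < k) :
    IsLocallyDeSitter (standardMetric f) M (1 / Real.sqrt k) := by
  have hw := Real.sq_sqrt hk.le
  have hw0 := (Real.sqrt_pos.2 hk).ne'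
  set w := Real.sqrt k
  have hk0 := hk.ne'
  have hL : (1 / w) ^ 2 * k = 1 := by rw [← hw]; field_simp
  have hlin : ∀ t, HasDerivAt (fun t : ℝ => w * t) w t := fun t => by
    simpa using (hasDerivAt_id t).const_mul w
  have hsinh : ∀ t, HasDerivAt (fun t => Real.sinh (w * t)) (Real.cosh (w * t) * w) t := fun t =>
    (hlin t).sinh
  have hcosh : ∀ t, HasDerivAt (fun t => Real.cosh (w * t)) (Real.sinh (w * t) * w) t := fun t =>
    (hlin t).cosh
  have hS : ContDiff ℝ ∞ fun t => Real.sinh (w * t) := Real.contDiff_sinh.comp (by fun_prop)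
  have hC : ContDiff ℝ ∞ fun t => Real.cosh (w * t) := Real.contDiff_cosh.comp (by fun_prop)
  -- M is connected and f has no zeros, so M lies on one side of the horizon f = 0.
  have hsign : (∀ x ∈ M, 0 < f (x 1)) ∨ ∀ x ∈ M, f (x 1) < 0 := by
    by_contra! h
    obtain ⟨⟨a, ha, hfa⟩, b, hb, hfb⟩ := h
    have hc : ContinuousOn (fun y : Coord => f (y 1)) M :=
      ContinuousOn.congr (f := fun y : Coord => 1 - k * y 1 ^ 2) (by fun_prop) hf
    obtain ⟨y, hy, hy0⟩ := hMc.intermediate_value ha hb hc ⟨hfa, hfb⟩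
    exact h0 y hy hy0
  rcases hsign with hpos | hneg
  -- Inside the horizon (A, B) runs along the spacelike branch (sinh, cosh) with m = 1. Beyond it, f
  -- < 0 requires q < 0 and the branch (cosh, sinh) with m = -1.
  · refine ⟨_, isLocalIsometry_staticEmbedding (q := 1 / k) (m := 1) (m' := -k) hM hf
      (fun x hx => mul_pos (by positivity) (hpos x hx)) hS hC hsinh hcosh
      ?_ ?_ ?_ (by field_simp) (by field_simp) hL⟩ <;> intro t
    · linear_combination Real.cosh_sq (w * t)
    · ring
    · linear_combination -w ^ 2 * Real.cosh_sq (w * t) - hw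
  · refine ⟨_, isLocalIsometry_staticEmbedding (q := -1 / k) (m := -1) (m' := k) hM hf
      (fun x hx => mul_pos_of_neg_of_neg (div_neg_of_neg_of_pos (by norm_num) hk) (hneg x hx))
      hC hS hcosh hsinh ?_ ?_ ?_ (by field_simp) (by field_simp) hL⟩ <;> intro t
    · linear_combination -Real.cosh_sq (w * t)
    · ring
    · linear_combination w ^ 2 * Real.cosh_sq (w * t) + hw

lemma isLocallyAntiDeSitter (hM : IsOpen M)
    (hf : ∀ x ∈ M, f (x 1) = 1 - k * x 1 ^ 2) (hk : k < 0) :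
    IsLocallyAntiDeSitter (standardMetric f) M (1 / Real.sqrt (-k)) := by
  have hw := Real.sq_sqrt (neg_pos.2 hk).le
  have hw0 := (Real.sqrt_pos.2 (neg_pos.2 hk)).ne'
  set w := Real.sqrt (-k)
  have hk0 := hk.ne
  have hL : -(1 / w) ^ 2 * k = 1 := by
    rw [show k = -w ^ 2 by linarith]
    field_simp
  have hlin : ∀ t, HasDerivAt (fun t : ℝ => w * t) w t := fun t => by
    simpa using (hasDerivAt_id t).const_mul w
  -- For k < 0 there is no horizon: f is positive throughout. The conic is a circle in the plane of
  -- the two negative directions.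
  refine ⟨_, isLocalIsometry_staticEmbedding (q := -1 / k) (m := -1) (m' := k)
    (A := fun t => Real.cos (w * t)) (B := fun t => Real.sin (w * t)) hM hf ?_
    (Real.contDiff_cos.comp (by fun_prop)) (Real.contDiff_sin.comp (by fun_prop))
    (fun t => (hlin t).cos) (fun t => (hlin t).sin)
    ?_ ?_ ?_ (by field_simp) (by field_simp) hL⟩
  · intro x hx
    rw [hf x hx]
    exact mul_pos (div_pos_of_neg_of_neg (by norm_num) hk)
      (by nlinarith [sq_nonneg (x 1)])
  · intro t
    linear_combination -Real.sin_sq_add_cos_sq (w * t)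
  · intro t
    ring
  · intro t
    linear_combination -w ^ 2 * Real.sin_sq_add_cos_sq (w * t) - hw

lemma isLocallyMinkowski (hf : ∀ x ∈ M, f (x 1) = 1) :
    IsLocallyMinkowski (standardMetric f) M := by
  have hcoord : ContDiff ℝ ∞ (fun y : Coord => y 0) := by fun_prop
  refine ⟨fun y => ![y 0, cartesian 0 y, cartesian 1 y, cartesian 2 y], ?_,
    Set.mapsTo_univ _ _, ?_⟩
  · rw [contDiffOn_pi]
    intro i
    fin_cases i
    · exact hcoord.contDiffOn
    · exact (contDiff_cartesian 0).contDiffOn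
    · exact (contDiff_cartesian 1).contDiffOn
    · exact (contDiff_cartesian 2).contDiffOn
  · intro x hx u v
    have hcart := fun i => ((contDiff_cartesian i).differentiable (by simp) x).hasFDerivAt
    have hd : HasFDerivAt (fun y => ![y 0, cartesian 0 y, cartesian 1 y, cartesian 2 y])
        (ContinuousLinearMap.pi ![ContinuousLinearMap.proj 0, fderiv ℝ (cartesian 0) x,
          fderiv ℝ (cartesian 1) x, fderiv ℝ (cartesian 2) x]) x := by
      rw [hasFDerivAt_pi]
      intro i
      fin_cases i
      · exact hasFDerivAt_coord 0
      · exact hcart 0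
      · exact hcart 1
      · exact hcart 2
    rw [hd.fderiv, scalarProd_standard, hf x hx]
    simp only [flatProd, Fin.sum_univ_four, ContinuousLinearMap.coe_pi', Matrix.cons_val,
      ContinuousLinearMap.proj_apply]
    linear_combination sum_fderiv_cartesian x u v

end

end StaticKundt

/-! ### The classification -/

theorem mainTheorem3 (f : ℝ → ℝ) (M : Set StaticKundt.Coord)
    (hM_open : IsOpen M) (hM_conn : IsConnected M)
    (hr : ∀ x ∈ M, 0 < x 1) (hθ : ∀ x ∈ M, 0 < x 2 ∧ x 2 < Real.pi)
    (hf_smooth : ContDiffOn ℝ ∞ f ((fun x : StaticKundt.Coord => x 1) '' M))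
    (hf_ne : ∀ x ∈ M, f (x 1) ≠ 0)
    (hKundt : ∃ l : StaticKundt.Coord → StaticKundt.Coord,
      StaticKundt.IsKundtCongruence (StaticKundt.standardMetric f) M l) :
    ∃ k : ℝ, StaticKundt.HasConstantCurvature (StaticKundt.standardMetric f) M k ∧
      ((0 < k ∧
          StaticKundt.IsLocallyDeSitter (StaticKundt.standardMetric f) M (1 / Real.sqrt k)) ∨
        (k < 0 ∧
          StaticKundt.IsLocallyAntiDeSitter (StaticKundt.standardMetric f) M
            (1 / Real.sqrt (-k))) ∨
        (k = 0 ∧ StaticKundt.IsLocallyMinkowski (StaticKundt.standardMetric f) M)) := by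
  obtain ⟨l, hK⟩ := hKundt
  have hr0 : ∀ x ∈ M, x 1 ≠ 0 := fun x hx => (hr x hx).ne'
  have hs : ∀ x ∈ M, Real.sin (x 2) ≠ 0 := fun x hx =>
    (Real.sin_pos_of_pos_of_lt_pi (hθ x hx).1 (hθ x hx).2).ne'
  -- The values of r form an open connected set, so a single constant k serves all of M.
  have hS : IsOpen ((fun x : StaticKundt.Coord => x 1) '' M) := isOpenMap_eval 1 M hM_open
  have hSc : IsPreconnected ((fun x : StaticKundt.Coord => x 1) '' M) :=
    hM_conn.isPreconnected.image _ (continuous_apply 1).continuousOn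
  have hf : ∀ x ∈ M, ContDiffAt ℝ ∞ f (x 1) := fun x hx =>
    hf_smooth.contDiffAt (hS.mem_nhds ⟨x, hx, rfl⟩)
  obtain ⟨k, hk⟩ := StaticKundt.exists_eq_one_sub_mul_sq hS hSc
    (by rintro _ ⟨x, hx, rfl⟩; exact hr0 x hx)
    (by rintro _ ⟨x, hx, rfl⟩; exact (hf x hx).differentiableAt (by simp))
    (by rintro _ ⟨x, hx, rfl⟩; exact hK.deriv_eq hM_open hr0 hs hf hf_ne hx)
  have hfk : ∀ x ∈ M, f (x 1) = 1 - k * x 1 ^ 2 := fun x hx => hk _ ⟨x, hx, rfl⟩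
  refine ⟨k, StaticKundt.hasConstantCurvature hM_open hr0 hs hf_ne hfk, ?_⟩
  rcases lt_trichotomy 0 k with hpos | rfl | hneg
  · exact Or.inl ⟨hpos, StaticKundt.isLocallyDeSitter hM_open hM_conn.isPreconnected hfk hf_ne hpos⟩
  · exact Or.inr (Or.inr ⟨rfl, StaticKundt.isLocallyMinkowski fun x hx => by simp [hfk x hx]⟩)
  · exact Or.inr (Or.inl ⟨hneg, StaticKundt.isLocallyAntiDeSitter hM_open hfk hneg⟩)
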